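/- Conventions. A groupoid $G$ is a small category with inverses, identified with its set of arrows; $G^{(0)}\subseteq G$ is the set of identity arrows (units), $r,s:G\to G^{(0)}$ are the range and source maps, and $gh$ is defined iff $s(g)=r(h)$. A topological groupoid is a groupoid with a locally compact topology for which all operations are continuous and $G^{(0)}$ is Hausdorff; it is a Hausdorff groupoid if $G$ is Hausdorff. It is étale if $G^{(0)}$ is open and $r,s:G\to G^{(0)}$ are local homeomorphisms, and ample if moreover $G^{(0)}$ is zero-dimensional (has a basis of clopen sets). Homomorphisms are functors, and $\cong$ denotes isomorphism of topological groupoids (a homomorphism that is a homeomorphism). For $X\subseteq G^{(0)}$ put $G|_X=\{g: r(g),s(g)\in X\}$; $X$ is full if for every $u\in G^{(0)}$ there is $g\in G$ with $s(g)=u$ and $r(g)\in X$. For a map $\psi:X\to G^{(0)}$ let $G^\psi=\{(x,\gamma,y)\in X\times G\times X:\psi(x)=r(\gamma),\ \psi(y)=s(\gamma)\}$, with the relative topology, $(x,\gamma,y)(y,\eta,z)=(x,\gamma\eta,z)$ and $(x,\gamma,y)^{-1}=(y,\gamma^{-1},x)$. **Theorem.** Let $G$ and $H$ be ample Hausdorff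 groupoids with $\sigma$-compact unit spaces. Then the following are equivalent: 1. $G$ and $H$ are similar: there are homomorphisms $\rho:G\to H$ and $\sigma:H\to G$ that are local homeomorphisms, such that $\sigma\circ\rho$ is similar to $\mathrm{id}_G$ and $\rho\circ\sigma$ is similar to $\mathrm{id}_H$. Here continuous homomorphisms $\alpha,\beta:A\to B$ are such that $\alpha$ is similar to $\beta$ if there is a continuous $\theta:A^{(0)}\to B$ with $\theta(r(g))\alpha(g)=\beta(g)\theta(s(g))$ for all $g\in A$ (both products being defined). 2. $G$ and $H$ are Morita equivalent in the sense of Crainic and Moerdijk: there are a topological groupoid $K$ and weak equivalences $K\to G$ and $K\to H$. A weak equivalence $\varphi:K\to G$ is a continuous homomorphism such that $(u,\gamma)\mapsto s(\gamma)$ is a surjective local homeomorphism from $\{(u,\gamma)\in K^{(0)}\times G:\varphi(u)=r(\gamma)\}$ onto $G^{(0)}$, and $k\mapsto(r(k),\varphi(k),s(k))$ is an isomorphism of topological groupoids from $K$ onto the fibred product $\{(u,\gamma,v)\in K^{(0)}\times G\times K^{(0)}: r(\gamma)=\varphi(u),\ s(\gamma)=\varphi(v)\}$. 3. There are an ample Hausdorff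 groupoid $L$ and a decomposition $L^{(0)}=X\sqcup Y$ into complementary full clopen subsets such that $L|_X\cong G$ and $L|_Y\cong H$. 4. $G$ and $H$ are equivalent in the sense of Renault: there is a locally compact Hausdorff space $Z$ that is a free and proper left $G$-space with continuous open anchor map $r:Z\to G^{(0)}$ and a free and proper right $H$-space with continuous open anchor map $s:Z\to H^{(0)}$, such that the two actions commute, $r$ induces a homeomorphism $Z/H\to G^{(0)}$, and $s$ induces a homeomorphism $G\backslash Z\to H^{(0)}$. (A left action is a continuous map $(g,z)\mapsto g\cdot z$ from $G*Z=\{(g,z):s(g)=r(z)\}$ to $Z$ with $r(g\cdot z)=r(g)$, $(gh)\cdot z=g\cdot(h\cdot z)$ and $r(z)\cdot z=z$; it is free and proper if $(g,z)\mapsto(g\cdot z,z)$ is a proper injection $G*Z\to Z\times Z$; right actions are analogous. That the actions commute includes $s(g\cdot z)=s(z)$ and $r(z\cdot h)=r(z)$.) 5. $G$ and $H$ admit isomorphic ampliations: there are locally compact Hausdorff spaces $X,Y$ and surjective local homeomorphisms $\phi:X\to G^{(0)}$, $\psi:Y\to H^{(0)}$ such that $G^\phi\cong H^\psi$. 6.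 $G\times\mathcal R\cong H\times\mathcal R$, where $\mathcal R=\mathbb N\times\mathbb N$ is the discrete full equivalence relation on $\mathbb N$. 7. $G$ and $H$ are Kakutani equivalent: there are full clopen sets $X\subseteq G^{(0)}$ and $Y\subseteq H^{(0)}$ with $G|_X\cong H|_Y$. 8. $G$ and $H$ are weakly Kakutani equivalent: there are full open sets $X\subseteq G^{(0)}$ and $Y\subseteq H^{(0)}$ with $G|_X\cong H|_Y$. -/

import Mathlib

universe u v

namespace TopGpd

/-- A groupoid (small category with inverses), presented by its set of arrows `G`. The units are
the identity arrows; `rng g` and `src g` are the identity arrows at the codomain and the domain of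
`g`, and `mul g h` is defined exactly when `src g = rng h`. -/
class ArrowGroupoid (G : Type u) where
  rng : G → G
  src : G → G
  mul : (g h : G) → src g = rng h → G
  inv : G → G
  rng_rng : ∀ g, rng (rng g) = rng g
  src_rng : ∀ g, src (rng g) = rng g
  rng_src : ∀ g, rng (src g) = src g
  src_src : ∀ g, src (src g) = src g
  rng_mul : ∀ g h (p : src g = rng h), rng (mul g h p) = rng g
  src_mul : ∀ g h (p : src g = rng h), src (mul g h p) = src h
  comp_assoc : ∀ g h k (p : src g = rng h) (q : src h = rng k),
    mul (mul g h p) k ((src_mul g h p).trans q) = mul g (mul h k q) (p.trans (rng_mul h k q).symm)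
  rng_mul_self : ∀ g, mul (rng g) g (src_rng g) = g
  mul_src_self : ∀ g, mul g (src g) (rng_src g).symm = g
  rng_inv : ∀ g, rng (inv g) = src g
  src_inv : ∀ g, src (inv g) = rng g
  comp_inv : ∀ g, mul g (inv g) (rng_inv g).symm = rng g
  inv_comp : ∀ g, mul (inv g) g (src_inv g) = src g

open ArrowGroupoid

/-- The unit space `G⁽⁰⁾`: the set of identity arrows (with the subspace topology). -/
def unitSpace (G : Type u) [ArrowGroupoid G] : Set G := {x | rng x = x}

/-- The range map `r : G → G⁽⁰⁾`. -/
def r {G : Type u} [ArrowGroupoid G] (g : G) : unitSpace G := ⟨rng g, rng_rng g⟩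

/-- The source map `s : G → G⁽⁰⁾`. -/
def s {G : Type u} [ArrowGroupoid G] (g : G) : unitSpace G := ⟨src g, rng_src g⟩

/-- Topological groupoid: a locally compact topology making all operations continuous, with
Hausdorff unit space. -/
structure IsTopological (G : Type u) [ArrowGroupoid G] [TopologicalSpace G] : Prop where
  locallyCompact : LocallyCompactSpace G
  continuous_rng : Continuous (rng : G → G)
  continuous_src : Continuous (src : G → G)
  continuous_inv : Continuous (inv : G → G)
  continuous_mul : Continuous
    (fun p : {p : G × G // src p.1 = rng p.2} => mul p.1.1 p.1.2 p.2)
  t2_unitSpace : T2Space (unitSpace G)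

/-- Étale groupoid. -/
structure IsEtale (G : Type u) [ArrowGroupoid G] [TopologicalSpace G] : Prop
    extends IsTopological G where
  isOpen_unitSpace : IsOpen (unitSpace G)
  isLocalHomeomorph_r : IsLocalHomeomorph (r : G → unitSpace G)
  isLocalHomeomorph_s : IsLocalHomeomorph (s : G → unitSpace G)

/-- Ample groupoid: étale, with zero-dimensional unit space (the clopen sets form a basis). -/
structure IsAmple (G : Type u) [ArrowGroupoid G] [TopologicalSpace G] : Prop
    extends IsEtale G where
  zeroDimensional : TopologicalSpace.IsTopologicalBasis {U : Set (unitSpace G) | IsClopen U}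

/-- Groupoid homomorphisms (functors). -/
structure IsHom {G : Type u} {H : Type v} [ArrowGroupoid G] [ArrowGroupoid H] (φ : G → H) :
    Prop where
  map_rng : ∀ g, φ (rng g) = rng (φ g)
  map_src : ∀ g, φ (src g) = src (φ g)
  map_mul : ∀ g h (p : src g = rng h) (q : src (φ g) = rng (φ h)),
    φ (mul g h p) = mul (φ g) (φ h) q

/-- The map `G⁽⁰⁾ → H⁽⁰⁾` induced by a homomorphism. -/
def IsHom.onUnits {G : Type u} {H : Type v} [ArrowGroupoid G] [ArrowGroupoid H] {φ : G → H}
    (hφ : IsHom φ) (x : unitSpace G) : unitSpace H :=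
  ⟨φ x.1, (hφ.map_rng x.1).symm.trans (congrArg φ x.2)⟩

/-- Isomorphism of topological groupoids. -/
def Isomorphic (G : Type u) (H : Type v) [ArrowGroupoid G] [TopologicalSpace G]
    [ArrowGroupoid H] [TopologicalSpace H] : Prop :=
  ∃ Φ : G ≃ₜ H, IsHom Φ

/-! Similarity -/

/-- The homomorphism `ρ` is similar to `σ`: there is a continuous `θ : G⁽⁰⁾ → H` such that both
sides of `θ(r(g)) ρ(g) = σ(g) θ(s(g))` are defined and agree, for every `g`. -/
def SimilarHom {G : Type u} {H : Type v} [ArrowGroupoid G] [TopologicalSpace G]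
    [ArrowGroupoid H] [TopologicalSpace H] (ρ σ : G → H) : Prop :=
  ∃ θ : unitSpace G → H, Continuous θ ∧ ∀ g : G,
    ∃ (p : src (θ (r g)) = rng (ρ g)) (q : src (σ g) = rng (θ (s g))),
      mul (θ (r g)) (ρ g) p = mul (σ g) (θ (s g)) q

/-- Similar groupoids. An étale homomorphism is one that is a local homeomorphism. -/
def SimilarGroupoids (G : Type u) (H : Type v) [ArrowGroupoid G] [TopologicalSpace G]
    [ArrowGroupoid H] [TopologicalSpace H] : Prop :=
  ∃ (ρ : G → H) (σ : H → G), IsHom ρ ∧ IsLocalHomeomorph ρ ∧ IsHom σ ∧ IsLocalHomeomorph σ ∧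
    SimilarHom (σ ∘ ρ) id ∧ SimilarHom (ρ ∘ σ) id

/-! Ampliations -/

/-- The ampliation `G^ψ = {(x, γ, y) | ψ(x) = r(γ), ψ(y) = s(γ)}` (a fibred product) of `G` along
a map `ψ : X → G⁽⁰⁾`. -/
def Ampliation {G : Type u} [ArrowGroupoid G] {X : Type v} (ψ : X → unitSpace G) :
    Type (max u v) :=
  {a : X × G × X // ψ a.1 = r a.2.1 ∧ ψ a.2.2 = s a.2.1}

/-- The relative topology from `X × G × X`. -/
instance {G : Type u} [ArrowGroupoid G] [TopologicalSpace G] {X : Type v} [TopologicalSpace X]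
    (ψ : X → unitSpace G) : TopologicalSpace (Ampliation ψ) :=
  inferInstanceAs
    (TopologicalSpace {a : X × G × X // ψ a.1 = r a.2.1 ∧ ψ a.2.2 = s a.2.1})

/-- `(x, γ, y)(y, η, z) = (x, γη, z)` and `(x, γ, y)⁻¹ = (y, γ⁻¹, x)`. -/
instance {G : Type u} [ArrowGroupoid G] {X : Type v} (ψ : X → unitSpace G) :
    ArrowGroupoid (Ampliation ψ) where
  rng a := ⟨(a.1.1, rng a.1.2.1, a.1.1),
    a.2.1.trans (Subtype.ext (rng_rng _).symm), a.2.1.trans (Subtype.ext (src_rng _).symm)⟩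
  src a := ⟨(a.1.2.2, src a.1.2.1, a.1.2.2),
    a.2.2.trans (Subtype.ext (rng_src _).symm), a.2.2.trans (Subtype.ext (src_src _).symm)⟩
  mul a b h := ⟨(a.1.1, mul a.1.2.1 b.1.2.1 (congrArg (fun c => c.1.2.1) h), b.1.2.2),
    a.2.1.trans (Subtype.ext (rng_mul _ _ _).symm),
    b.2.2.trans (Subtype.ext (src_mul _ _ _).symm)⟩
  inv a := ⟨(a.1.2.2, inv a.1.2.1, a.1.1),
    a.2.2.trans (Subtype.ext (rng_inv _).symm), a.2.1.trans (Subtype.ext (src_inv _).symm)⟩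
  rng_rng a := Subtype.ext (by simp [rng_rng])
  src_rng a := Subtype.ext (by simp [src_rng])
  rng_src a := Subtype.ext (by simp [rng_src])
  src_src a := Subtype.ext (by simp [src_src])
  rng_mul a b p := Subtype.ext (by simp [rng_mul])
  src_mul a b p := Subtype.ext (by simp [src_mul])
  comp_assoc a b c p q := Subtype.ext (Prod.ext rfl (Prod.ext
    (comp_assoc _ _ _ (congrArg (fun c => c.1.2.1) p) (congrArg (fun c => c.1.2.1) q)) rfl))
  rng_mul_self a := Subtype.ext (by simp [rng_mul_self])
  mul_src_self a := Subtype.ext (by simp [mul_src_self])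
  rng_inv a := Subtype.ext (by simp [rng_inv])
  src_inv a := Subtype.ext (by simp [src_inv])
  comp_inv a := Subtype.ext (by simp [comp_inv])
  inv_comp a := Subtype.ext (by simp [inv_comp])

/-- `G` and `H` admit isomorphic ampliations, along surjective local homeomorphisms defined on
locally compact Hausdorff spaces. -/
def HaveIsomorphicAmpliations (G H : Type u) [ArrowGroupoid G] [TopologicalSpace G]
    [ArrowGroupoid H] [TopologicalSpace H] : Prop :=
  ∃ (X Y : Type u) (_ : TopologicalSpace X) (_ : TopologicalSpace Y)
    (φ : X → unitSpace G) (ψ : Y → unitSpace H),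
    LocallyCompactSpace X ∧ T2Space X ∧ LocallyCompactSpace Y ∧ T2Space Y ∧
    IsLocalHomeomorph φ ∧ Function.Surjective φ ∧
    IsLocalHomeomorph ψ ∧ Function.Surjective ψ ∧
    Isomorphic (Ampliation φ) (Ampliation ψ)

/-! Morita equivalence -/

/-- A weak equivalence `φ : G → H`: a continuous homomorphism such that
`{(x, γ) ∈ G⁽⁰⁾ × H | φ(x) = r(γ)} → H⁽⁰⁾, (x, γ) ↦ s(γ)` is an étale surjection (a surjective
local homeomorphism), and such that `g ↦ (r(g), φ(g), s(g))` is an isomorphism of topological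
groupoids from `G` onto the fibred product `{(x, γ, y) ∈ G⁽⁰⁾ × H × G⁽⁰⁾ | r(γ) = φ(x),
s(γ) = φ(y)}`. -/
def IsWeakEquivalence {G : Type u} {H : Type v} [ArrowGroupoid G] [TopologicalSpace G]
    [ArrowGroupoid H] [TopologicalSpace H] (φ : G → H) : Prop :=
  Continuous φ ∧ ∃ hφ : IsHom φ,
    IsLocalHomeomorph
      (fun a : {a : unitSpace G × H // hφ.onUnits a.1 = r a.2} => s a.1.2) ∧
    Function.Surjective
      (fun a : {a : unitSpace G × H // hφ.onUnits a.1 = r a.2} => s a.1.2) ∧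
    ∃ Φ : G ≃ₜ Ampliation hφ.onUnits, IsHom Φ ∧ ∀ g, (Φ g).1 = (r g, φ g, s g)

/-- Morita equivalence: there are a topological groupoid `K` and weak equivalences
`G ← K → H`. -/
def MoritaEquivalent (G H : Type u) [ArrowGroupoid G] [TopologicalSpace G]
    [ArrowGroupoid H] [TopologicalSpace H] : Prop :=
  ∃ (K : Type u) (_ : ArrowGroupoid K) (_ : TopologicalSpace K) (φ : K → G) (ψ : K → H),
    IsTopological K ∧ IsWeakEquivalence φ ∧ IsWeakEquivalence ψ

/-! Restrictions, full sets, linking groupoids, Kakutani equivalence -/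

/-- The restriction `G|_X = {g | r(g) ∈ X, s(g) ∈ X}`. -/
def Restriction {G : Type u} [ArrowGroupoid G] (X : Set (unitSpace G)) : Type u :=
  {g : G // r g ∈ X ∧ s g ∈ X}

instance {G : Type u} [ArrowGroupoid G] [TopologicalSpace G] (X : Set (unitSpace G)) :
    TopologicalSpace (Restriction X) :=
  inferInstanceAs (TopologicalSpace {g : G // r g ∈ X ∧ s g ∈ X})

instance {G : Type u} [ArrowGroupoid G] (X : Set (unitSpace G)) :
    ArrowGroupoid (Restriction X) where
  rng a := ⟨rng a.1, by simpa only [r, s, rng_rng, src_rng, and_self] using a.2.1⟩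
  src a := ⟨src a.1, by simpa only [r, s, rng_src, src_src, and_self] using a.2.2⟩
  mul a b h := ⟨mul a.1 b.1 (congrArg Subtype.val h), by
    simpa only [r, s, rng_mul, src_mul] using And.intro a.2.1 b.2.2⟩
  inv a := ⟨inv a.1, by simpa only [r, s, rng_inv, src_inv] using a.2.symm⟩
  rng_rng a := Subtype.ext (rng_rng a.1)
  src_rng a := Subtype.ext (src_rng a.1)
  rng_src a := Subtype.ext (rng_src a.1)
  src_src a := Subtype.ext (src_src a.1)
  rng_mul a b p := Subtype.ext (rng_mul a.1 b.1 _)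
  src_mul a b p := Subtype.ext (src_mul a.1 b.1 _)
  comp_assoc a b c p q := Subtype.ext (comp_assoc a.1 b.1 c.1 _ _)
  rng_mul_self a := Subtype.ext (rng_mul_self a.1)
  mul_src_self a := Subtype.ext (mul_src_self a.1)
  rng_inv a := Subtype.ext (rng_inv a.1)
  src_inv a := Subtype.ext (src_inv a.1)
  comp_inv a := Subtype.ext (comp_inv a.1)
  inv_comp a := Subtype.ext (inv_comp a.1)

/-- The orbit `[x] = r(G_x)` of a unit. -/
def orbit {G : Type u} [ArrowGroupoid G] (x : unitSpace G) : Set (unitSpace G) :=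
  {y | ∃ g : G, s g = x ∧ r g = y}

/-- A set of units is full if it meets every orbit. -/
def IsFull {G : Type u} [ArrowGroupoid G] (X : Set (unitSpace G)) : Prop :=
  ∀ x : unitSpace G, (X ∩ orbit x).Nonempty

/-- There are an ample Hausdorff groupoid `L` and a decomposition `L⁽⁰⁾ = X ⊔ Y` into
complementary full clopen sets with `L|_X ≅ G` and `L|_Y ≅ H`. -/
def HasAmpleLinkingGroupoid (G H : Type u) [ArrowGroupoid G] [TopologicalSpace G]
    [ArrowGroupoid H] [TopologicalSpace H] : Prop :=
  ∃ (L : Type u) (_ : ArrowGroupoid L) (_ : TopologicalSpace L) (X Y : Set (unitSpace L)),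
    IsAmple L ∧ T2Space L ∧ IsCompl X Y ∧ IsClopen X ∧ IsClopen Y ∧ IsFull X ∧ IsFull Y ∧
    Isomorphic (Restriction X) G ∧ Isomorphic (Restriction Y) H

/-- Weak Kakutani equivalence. -/
def WeaklyKakutaniEquivalent (G : Type u) (H : Type v) [ArrowGroupoid G] [TopologicalSpace G]
    [ArrowGroupoid H] [TopologicalSpace H] : Prop :=
  ∃ (X : Set (unitSpace G)) (Y : Set (unitSpace H)),
    IsOpen X ∧ IsFull X ∧ IsOpen Y ∧ IsFull Y ∧ Isomorphic (Restriction X) (Restriction Y)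

/-- Kakutani equivalence. -/
def KakutaniEquivalent (G : Type u) (H : Type v) [ArrowGroupoid G] [TopologicalSpace G]
    [ArrowGroupoid H] [TopologicalSpace H] : Prop :=
  ∃ (X : Set (unitSpace G)) (Y : Set (unitSpace H)),
    IsClopen X ∧ IsFull X ∧ IsClopen Y ∧ IsFull Y ∧ Isomorphic (Restriction X) (Restriction Y)

/-! Equivalence in the sense of Renault -/

/-- A left `G`-space structure on `Z`; `act g z` is defined when `s(g) = anchor z`. -/
structure LeftSpace (G : Type u) (Z : Type v) [ArrowGroupoid G] [TopologicalSpace G]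
    [TopologicalSpace Z] where
  anchor : Z → unitSpace G
  continuous_anchor : Continuous anchor
  isOpenMap_anchor : IsOpenMap anchor
  act : (g : G) → (z : Z) → s g = anchor z → Z
  continuous_act : Continuous (fun a : {a : G × Z // s a.1 = anchor a.2} => act a.1.1 a.1.2 a.2)
  anchor_act : ∀ g z p, anchor (act g z p) = r g
  mul_act : ∀ g h z (p : src g = rng h) (q : s (mul g h p) = anchor z) (q₁ : s h = anchor z)
    (q₂ : s g = anchor (act h z q₁)), act (mul g h p) z q = act g (act h z q₁) q₂
  unit_act : ∀ z (p : s (anchor z).1 = anchor z), act (anchor z).1 z p = z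

/-- Free and proper: `(g, z) ↦ (g · z, z)` is a proper injection from `G * Z` to `Z × Z`. -/
def LeftSpace.IsFreeProper {G : Type u} {Z : Type v} [ArrowGroupoid G] [TopologicalSpace G]
    [TopologicalSpace Z] (A : LeftSpace G Z) : Prop :=
  Function.Injective
    (fun a : {a : G × Z // s a.1 = A.anchor a.2} => (A.act a.1.1 a.1.2 a.2, a.1.2)) ∧
  IsProperMap
    (fun a : {a : G × Z // s a.1 = A.anchor a.2} => (A.act a.1.1 a.1.2 a.2, a.1.2))

/-- The orbit space `G \ Z`, with the quotient topology. -/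
abbrev LeftSpace.OrbitSpace {G : Type u} {Z : Type v} [ArrowGroupoid G] [TopologicalSpace G]
    [TopologicalSpace Z] (A : LeftSpace G Z) : Type v :=
  Quot (fun z w : Z => ∃ (g : G) (p : s g = A.anchor z), A.act g z p = w)

/-- A right `H`-space structure on `Z`; `act z h` is defined when `anchor z = r(h)`. -/
structure RightSpace (H : Type u) (Z : Type v) [ArrowGroupoid H] [TopologicalSpace H]
    [TopologicalSpace Z] where
  anchor : Z → unitSpace H
  continuous_anchor : Continuous anchor
  isOpenMap_anchor : IsOpenMap anchor
  act : (z : Z) → (h : H) → anchor z = r h → Z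
  continuous_act : Continuous (fun a : {a : Z × H // anchor a.1 = r a.2} => act a.1.1 a.1.2 a.2)
  anchor_act : ∀ z h p, anchor (act z h p) = s h
  act_mul : ∀ z g h (p : src g = rng h) (q : anchor z = r (mul g h p)) (q₁ : anchor z = r g)
    (q₂ : anchor (act z g q₁) = r h), act z (mul g h p) q = act (act z g q₁) h q₂
  act_unit : ∀ z (p : anchor z = r (anchor z).1), act z (anchor z).1 p = z

/-- Free and proper: `(z, h) ↦ (z · h, z)` is a proper injection from `Z * H` to `Z × Z`. -/
def RightSpace.IsFreeProper {H : Type u} {Z : Type v} [ArrowGroupoid H] [TopologicalSpace H]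
    [TopologicalSpace Z] (B : RightSpace H Z) : Prop :=
  Function.Injective
    (fun a : {a : Z × H // B.anchor a.1 = r a.2} => (B.act a.1.1 a.1.2 a.2, a.1.1)) ∧
  IsProperMap
    (fun a : {a : Z × H // B.anchor a.1 = r a.2} => (B.act a.1.1 a.1.2 a.2, a.1.1))

/-- The orbit space `Z / H`, with the quotient topology. -/
abbrev RightSpace.OrbitSpace {H : Type u} {Z : Type v} [ArrowGroupoid H] [TopologicalSpace H]
    [TopologicalSpace Z] (B : RightSpace H Z) : Type v :=
  Quot (fun z w : Z => ∃ (h : H) (p : B.anchor z = r h), B.act z h p = w)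

/-- The two actions commute: each leaves the anchor map of the other invariant, and
`(g · z) · h = g · (z · h)`. -/
def ActionsCommute {G H : Type u} {Z : Type v} [ArrowGroupoid G] [TopologicalSpace G]
    [ArrowGroupoid H] [TopologicalSpace H] [TopologicalSpace Z]
    (A : LeftSpace G Z) (B : RightSpace H Z) : Prop :=
  (∀ g z p, B.anchor (A.act g z p) = B.anchor z) ∧
  (∀ z h p, A.anchor (B.act z h p) = A.anchor z) ∧
  ∀ g z h (p : s g = A.anchor z) (q : B.anchor z = r h)
    (q' : B.anchor (A.act g z p) = r h) (p' : s g = A.anchor (B.act z h q)),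
    B.act (A.act g z p) h q' = A.act g (B.act z h q) p'

/-- Equivalence of groupoids in the sense of Renault. -/
def RenaultEquivalent (G H : Type u) [ArrowGroupoid G] [TopologicalSpace G]
    [ArrowGroupoid H] [TopologicalSpace H] : Prop :=
  ∃ (Z : Type u) (_ : TopologicalSpace Z) (A : LeftSpace G Z) (B : RightSpace H Z),
    LocallyCompactSpace Z ∧ T2Space Z ∧ A.IsFreeProper ∧ B.IsFreeProper ∧ ActionsCommute A B ∧
    (∃ Φ : B.OrbitSpace ≃ₜ unitSpace G, ∀ z, Φ (Quot.mk _ z) = A.anchor z) ∧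
    (∃ Ψ : A.OrbitSpace ≃ₜ unitSpace H, ∀ z, Ψ (Quot.mk _ z) = B.anchor z)

/-! Stable isomorphism -/

/-- The product of two groupoids. -/
instance {G : Type u} {H : Type v} [ArrowGroupoid G] [ArrowGroupoid H] :
    ArrowGroupoid (G × H) where
  rng a := (rng a.1, rng a.2)
  src a := (src a.1, src a.2)
  mul a b h := (mul a.1 b.1 (congrArg Prod.fst h), mul a.2 b.2 (congrArg Prod.snd h))
  inv a := (inv a.1, inv a.2)
  rng_rng a := by simp [rng_rng]
  src_rng a := by simp [src_rng]
  rng_src a := by simp [rng_src]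
  src_src a := by simp [src_src]
  rng_mul a b p := by simp [rng_mul]
  src_mul a b p := by simp [src_mul]
  comp_assoc a b c p q := Prod.ext
    (comp_assoc _ _ _ (congrArg Prod.fst p) (congrArg Prod.fst q))
    (comp_assoc _ _ _ (congrArg Prod.snd p) (congrArg Prod.snd q))
  rng_mul_self a := by simp [rng_mul_self]
  mul_src_self a := by simp [mul_src_self]
  rng_inv a := by simp [rng_inv]
  src_inv a := by simp [src_inv]
  comp_inv a := by simp [comp_inv]
  inv_comp a := by simp [inv_comp]

/-- The full equivalence relation on `ℕ`; its elements are the pairs `(m, n)`. -/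
structure FullRel where
  m : ℕ
  n : ℕ

/-- The discrete topology. -/
instance : TopologicalSpace FullRel := ⊥

/-- `r(m, n) = m`, `s(m, n) = n` (with `n` identified with `(n, n)`), `(m, n)(n, k) = (m, k)`. -/
instance : ArrowGroupoid FullRel where
  rng a := ⟨a.m, a.m⟩
  src a := ⟨a.n, a.n⟩
  mul a b _ := ⟨a.m, b.n⟩
  inv a := ⟨a.n, a.m⟩
  rng_rng _ := rfl
  src_rng _ := rfl
  rng_src _ := rfl
  src_src _ := rfl
  rng_mul _ _ _ := rfl
  src_mul _ _ _ := rfl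
  comp_assoc _ _ _ _ _ := rfl
  rng_mul_self _ := rfl
  mul_src_self _ := rfl
  rng_inv _ := rfl
  src_inv _ := rfl
  comp_inv _ := rfl
  inv_comp _ := rfl

end TopGpd

/-!
All eight conditions amount to saying that some ampliation of `G` is isomorphic to some ampliation
of `H`: the groupoids `G × 𝓡`, `G|_X` for full open `X`, and any `K` with a weak equivalence to `G`
are the ampliations of `G` along `G⁽⁰⁾ × ℕ → G⁽⁰⁾`, along `X ⊆ G⁽⁰⁾`, and along `K⁽⁰⁾ → G⁽⁰⁾`.
Two kinds of argument are needed.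

*Changing the base of an ampliation.* If `G^φ ≅ H^ψ` for surjective local homeomorphisms, one may
identify the two bases with one space `X`, which is then a correspondence `G⁽⁰⁾ ← X → H⁽⁰⁾`, and the
isomorphism persists after pulling back along any `T → X` (`Isomorphic.ampliation_comp`). So it
remains to find good subspaces of `X` or of `X × ℕ × ℕ`, which is a matter of topology:

* `exists_stable_matching` finds an open subset of `X × ℕ × ℕ` that is at once a copy of
  `G⁽⁰⁾ × ℕ` and of `H⁽⁰⁾ × ℕ`; this gives `G × 𝓡 ≅ H × 𝓡`. It is a Cantor–Schröder–Bernstein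
  argument in which each step back and forth raises the `ℕ`-coordinate, so that the set built by
  the argument is a locally finite union of clopen sets (`exists_isOpen_bijOn_of_levels`).
* `exists_isOpen_clopen_matching` finds, when `X` is `σ`-compact, an open subset of `X` mapped
  homeomorphically onto full clopen subsets of `G⁽⁰⁾` and `H⁽⁰⁾`; this gives Kakutani equivalence.

*Producing ampliations.* For an equivalence `Z` in the sense of Renault, freeness and properness make
the anchor maps local homeomorphisms and the translation maps continuous, whence the ampliations of
`G` and `H` along them agree (`RenaultEquivalent.haveIsomorphicAmpliations`). A span of weak
equivalences `G ← K → H` gives ampliations along the space of triples `(x, γ, η)` in `K⁽⁰⁾ × G × H`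
with `γ` ending at the image of `x` in `G⁽⁰⁾` and `η` at its image in `H⁽⁰⁾`; passing from `x` to the
other ends of `γ` and `η` makes the maps surjective
(`MoritaEquivalent.haveIsomorphicAmpliations`). If `ρ : G → H` is one half of a similarity, then `G`
is the ampliation of `H` along `G⁽⁰⁾ → H⁽⁰⁾`, and the ampliation of `H` along `G⁽⁰⁾ ⊔ H⁽⁰⁾ → H⁽⁰⁾` is
a linking groupoid (`SimilarGroupoids.hasAmpleLinkingGroupoid`), in which the arrows between the two
parts of the unit space form an equivalence (`HasAmpleLinkingGroupoid.renaultEquivalent`).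
Finally an isomorphism `G × 𝓡 ≅ H × 𝓡` compresses to a similarity
(`similarGroupoids_of_isomorphic_prod_fullRel`).
-/

namespace TopGpd

open ArrowGroupoid Set Topology TopologicalSpace

/-! ### Local homeomorphisms and spaces with a basis of compact open sets -/

section Topology

variable {X Y Z P : Type*} [TopologicalSpace X] [TopologicalSpace Y] [TopologicalSpace Z]
  [TopologicalSpace P]

theorem isLocalHomeomorph_of_locallyInjective {f : X → Y} (hc : Continuous f) (ho : IsOpenMap f)
    (hi : IsLocallyInjective f) : IsLocalHomeomorph f := by
  rw [isLocalHomeomorph_iff_isOpenEmbedding_restrict]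
  intro x
  obtain ⟨U, hU, hx, hinj⟩ := hi x
  refine ⟨U, hU.mem_nhds hx, .of_continuous_injective_isOpenMap
    (hc.comp continuous_subtype_val) hinj.injective (ho.comp hU.isOpenMap_subtype_val)⟩

/-- Local homeomorphisms are stable under base change. The fibre product is given by an arbitrary
space `P` carrying the two projections `u` and `v`. -/
theorem isLocalHomeomorph_of_isPullback {f : X → Z} {g : Y → Z} {u : P → X} {v : P → Y}
    (hf : IsLocalHomeomorph f) (hg : Continuous g)
    (hP : IsEmbedding fun p => (u p, v p)) (hcomm : ∀ p, f (u p) = g (v p))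
    (hex : ∀ x y, f x = g y → ∃ p, u p = x ∧ v p = y) : IsLocalHomeomorph v := by
  have hu : Continuous u := continuous_fst.comp hP.continuous
  have hv : Continuous v := continuous_snd.comp hP.continuous
  refine isLocalHomeomorph_of_locallyInjective hv ?_ ?_
  · refine IsOpenMap.of_nhds_le fun p => ?_
    intro N hN
    rw [Filter.mem_map, hP.isInducing.nhds_eq_comap, Filter.mem_comap] at hN
    obtain ⟨W, hW, hWN⟩ := hN
    obtain ⟨W₁, hW₁, W₂, hW₂, h12⟩ := mem_nhds_prod_iff.1 hW
    have h1 : f '' W₁ ∈ 𝓝 (g (v p)) := by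
      rw [← hcomm]; exact hf.isOpenMap.image_mem_nhds hW₁
    filter_upwards [hW₂, hg.continuousAt h1] with y hy hy'
    obtain ⟨x, hx, hxy⟩ := hy'
    obtain ⟨q, rfl, rfl⟩ := hex x y hxy
    exact hWN (h12 ⟨hx, hy⟩)
  · intro p
    obtain ⟨U, hU, hx, hinj⟩ := hf.isLocallyInjective (u p)
    refine ⟨u ⁻¹' U, hU.preimage hu, hx, fun p hp q hq hpq => hP.injective (Prod.ext ?_ hpq)⟩
    exact hinj hp hq (by rw [hcomm, hcomm, hpq])

theorem prespectralSpace_of_isClopen_basis [LocallyCompactSpace X]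
    (h : IsTopologicalBasis {U : Set X | IsClopen U}) : PrespectralSpace X := by
  refine ⟨isTopologicalBasis_of_isOpen_of_nhds (fun U hU => hU.1) fun x U hx hU => ?_⟩
  obtain ⟨K, hK, hxK, hKU⟩ := exists_compact_subset hU hx
  obtain ⟨V, hV, hxV, hVK⟩ := h.exists_subset_of_mem_open hxK isOpen_interior
  exact ⟨V, ⟨hV.isOpen, hK.of_isClosed_subset hV.isClosed (hVK.trans interior_subset)⟩, hxV,
    hVK.trans (interior_subset.trans hKU)⟩

theorem isClopen_basis_of_prespectralSpace [T2Space X] [PrespectralSpace X] :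
    IsTopologicalBasis {U : Set X | IsClopen U} := by
  refine isTopologicalBasis_of_isOpen_of_nhds (fun U hU => hU.isOpen) fun x U hx hU => ?_
  obtain ⟨V, hV, hxV, hVU⟩ :=
    PrespectralSpace.isTopologicalBasis.exists_subset_of_mem_open hx hU
  exact ⟨V, ⟨hV.2.isClosed, hV.1⟩, hxV, hVU⟩

theorem exists_compactOpen_injOn [PrespectralSpace X] {f : X → Y} (hf : IsLocalHomeomorph f) (x : X)
    {U : Set X} (hU : IsOpen U) (hx : x ∈ U) :
    ∃ V, IsOpen V ∧ IsCompact V ∧ x ∈ V ∧ V ⊆ U ∧ InjOn f V := by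
  obtain ⟨W, hW, hxW, hinj⟩ := hf.isLocallyInjective x
  obtain ⟨V, hV, hxV, hVU⟩ := PrespectralSpace.isTopologicalBasis.exists_subset_of_mem_open
    (show x ∈ U ∩ W from ⟨hx, hxW⟩) (hU.inter hW)
  exact ⟨V, hV.1, hV.2, hxV, fun y hy => (hVU hy).1, hinj.mono fun y hy => (hVU hy).2⟩

theorem prespectralSpace_of_isLocalHomeomorph [PrespectralSpace Y] {f : X → Y}
    (hf : IsLocalHomeomorph f) : PrespectralSpace X := by
  refine ⟨isTopologicalBasis_of_isOpen_of_nhds (fun U hU => hU.1) fun x U hx hU => ?_⟩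
  obtain ⟨e, hxe, rfl⟩ := hf x
  obtain ⟨V, hV, hxV, hVU⟩ := PrespectralSpace.isTopologicalBasis.exists_subset_of_mem_open
    (show e x ∈ e '' (e.source ∩ U) from ⟨x, ⟨hxe, hx⟩, rfl⟩)
    (e.isOpen_image_source_inter hU)
  have hVt : V ⊆ e.target := fun y hy => by
    obtain ⟨z, hz, rfl⟩ := hVU hy
    exact e.map_source hz.1
  refine ⟨e.symm '' V, ⟨e.symm.isOpen_image_of_subset_source hV.1 hVt,
    hV.2.image_of_continuousOn (e.continuousOn_symm.mono hVt)⟩, ⟨e x, hxV, e.left_inv hxe⟩, ?_⟩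
  rintro _ ⟨y, hy, rfl⟩
  obtain ⟨z, hz, rfl⟩ := hVU hy
  rw [e.left_inv hz.1]
  exact hz.2

/-- A countable cover of `T` by the images of compact open sets on which two given local
homeomorphisms are injective. -/
theorem exists_countable_compactOpen_cover {E A B T : Type*} [TopologicalSpace E]
    [TopologicalSpace A] [TopologicalSpace B] [TopologicalSpace T] [PrespectralSpace E]
    [SigmaCompactSpace T] {a : E → A} {b : E → B} {p : E → T}
    (ha : IsLocalHomeomorph a) (hb : IsLocalHomeomorph b) (hp : IsOpenMap p)
    (hs : Function.Surjective p) :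
    ∃ V : ℕ → Set E, (∀ k, IsOpen (V k)) ∧ (∀ k, IsCompact (V k)) ∧ (∀ k, InjOn a (V k)) ∧
      (∀ k, InjOn b (V k)) ∧ ∀ t, ∃ k, t ∈ p '' V k := by
  have key : ∀ t : T, ∃ V : Set E, IsOpen V ∧ IsCompact V ∧ InjOn a V ∧ InjOn b V ∧
      p '' V ∈ 𝓝 t := by
    intro t
    obtain ⟨e, rfl⟩ := hs t
    obtain ⟨V, hV, -, heV, -, hVi⟩ := exists_compactOpen_injOn ha e isOpen_univ (mem_univ e)
    obtain ⟨W, hW, hWc, heW, hWV, hWi⟩ := exists_compactOpen_injOn hb e hV heV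
    exact ⟨W, hW, hWc, hVi.mono hWV, hWi, hp.image_mem_nhds (hW.mem_nhds heW)⟩
  choose V hVo hVc hVa hVb hVn using key
  obtain ⟨c, hc, hcov⟩ := countable_cover_nhds_of_sigmaCompact hVn
  rcases c.eq_empty_or_nonempty with rfl | hne
  · refine ⟨fun _ => ∅, fun _ => isOpen_empty, fun _ => isCompact_empty, fun _ => injOn_empty _,
      fun _ => injOn_empty _, fun t => ?_⟩
    have := hcov.symm ▸ mem_univ t
    simp at this
  · obtain ⟨f, rfl⟩ := hc.exists_eq_range hne
    refine ⟨fun k => V (f k), fun _ => hVo _, fun _ => hVc _, fun _ => hVa _, fun _ => hVb _,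
      fun t => ?_⟩
    have : t ∈ ⋃ x ∈ range f, p '' V x := hcov.symm ▸ mem_univ t
    simpa using this

end Topology

/-! ### Matchings -/

section Matching

theorem isClopen_image_inter_preimage {P A B : Type*} [TopologicalSpace P] [TopologicalSpace A]
    [TopologicalSpace B] {α : P → A} {β : P → B} (hα : Continuous α) (hβ : IsOpenMap β) {K : Set P}
    (hK : IsOpen K) (hi : InjOn β K) (hc : IsClosed (β '' K)) {D : Set A} (hD : IsClopen D) :
    IsClopen (β '' (K ∩ α ⁻¹' D)) := by
  refine ⟨?_, hβ _ (hK.inter (hD.isOpen.preimage hα))⟩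
  have : β '' (K ∩ α ⁻¹' D) = β '' K \ β '' (K ∩ α ⁻¹' Dᶜ) := by
    rw [← hi.image_sdiff_subset inter_subset_left]
    congr 1
    ext x
    simp only [mem_inter_iff, mem_preimage, mem_sdiff, mem_compl_iff]
    tauto
  rw [this]
  exact hc.sdiff (hβ _ (hK.inter (hD.compl.isOpen.preimage hα)))

/-- A topological Cantor–Schröder–Bernstein theorem for correspondences. A subset of `P` on which
`α` and `β` are injective is a partial matching between `A` and `B`; `F` matches all of `A`
and `G` matches all of `B`. As going back and forth raises the level `ℓ`, the set of points of `A`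
to be matched by `F` is a locally finite union of clopen sets, so the result is open. -/
theorem exists_isOpen_bijOn_of_levels {P A B : Type*} [TopologicalSpace P] [TopologicalSpace A]
    [TopologicalSpace B] {α : P → A} {β : P → B} (hα : Continuous α) (hαo : IsOpenMap α)
    (hβ : Continuous β) (hβo : IsOpenMap β) {F G : Set P} (hF : IsOpen F) (hG : IsOpen G)
    (hFα : BijOn α F univ) (hFβ : InjOn β F) (hFc : IsClosed (β '' F))
    (hGβ : BijOn β G univ) (hGα : InjOn α G) (hGc : IsClosed (α '' G))
    {ℓ : A → ℕ} (hℓ : Continuous ℓ)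
    (hlt : ∀ e ∈ F, ∀ e' ∈ G, β e = β e' → ℓ (α e) < ℓ (α e')) :
    ∃ S : Set P, IsOpen S ∧ BijOn α S univ ∧ BijOn β S univ := by
  -- one round trip of the back-and-forth
  let T : Set A → Set A := fun D => α '' (G ∩ β ⁻¹' (β '' (F ∩ α ⁻¹' D)))
  have hT : ∀ D, IsClopen D → IsClopen (T D) := fun D hD =>
    isClopen_image_inter_preimage hβ hαo hG hGα hGc (isClopen_image_inter_preimage hα hβo hF hFβ hFc hD)
  let D₀ : Set A := (α '' G)ᶜ
  have hD₀ : IsClopen D₀ := (show IsClopen (α '' G) from ⟨hGc, hαo _ hG⟩).compl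
  have hclop : ∀ n, IsClopen (T^[n] D₀) := by
    intro n
    induction n with
    | zero => exact hD₀
    | succ n ih => rw [Function.iterate_succ_apply']; exact hT _ ih
  have hlev : ∀ n, ∀ x ∈ T^[n] D₀, n ≤ ℓ x := by
    intro n
    induction n with
    | zero => exact fun _ _ => Nat.zero_le _
    | succ n ih =>
      rw [Function.iterate_succ_apply']
      rintro _ ⟨e', ⟨he', e, ⟨he, heD⟩, hee⟩, rfl⟩
      exact (ih _ heD).trans_lt (hlt e he e' he' hee)
  let C : Set A := ⋃ n, T^[n] D₀
  have hC : IsClopen C := by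
    refine ⟨LocallyFinite.isClosed_iUnion (fun x => ?_) fun n => (hclop n).isClosed,
      isOpen_iUnion fun n => (hclop n).isOpen⟩
    refine ⟨ℓ ⁻¹' {ℓ x}, ((isOpen_discrete _).preimage hℓ).mem_nhds rfl,
      (finite_Iic (ℓ x)).subset ?_⟩
    rintro n ⟨y, hy, hyx⟩
    exact (hlev n y hy).trans (le_of_eq hyx)
  -- membership in `C`, for a point matched by `G`
  have hCG : ∀ e' ∈ G, α e' ∈ C → ∃ e ∈ F, α e ∈ C ∧ β e = β e' := by
    intro e' he' hC'
    obtain ⟨n, hn⟩ := mem_iUnion.1 hC'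
    cases n with
    | zero => exact absurd ⟨e', he', rfl⟩ hn
    | succ n =>
      rw [Function.iterate_succ_apply'] at hn
      obtain ⟨e'', ⟨he'', e, ⟨he, heD⟩, hee⟩, h⟩ := hn
      obtain rfl := hGα he'' he' h
      exact ⟨e, he, mem_iUnion.2 ⟨n, heD⟩, hee⟩
  have hCF : ∀ e ∈ F, ∀ e' ∈ G, β e = β e' → α e ∈ C → α e' ∈ C := by
    intro e he e' he' h hC'
    obtain ⟨n, hn⟩ := mem_iUnion.1 hC'
    refine mem_iUnion.2 ⟨n + 1, ?_⟩
    rw [Function.iterate_succ_apply']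
    exact ⟨e', ⟨he', e, ⟨he, hn⟩, h⟩, rfl⟩
  refine ⟨F ∩ α ⁻¹' C ∪ G ∩ α ⁻¹' Cᶜ, (hF.inter (hC.isOpen.preimage hα)).union
    (hG.inter (hC.compl.isOpen.preimage hα)), ⟨mapsTo_univ _ _, ?_, ?_⟩, mapsTo_univ _ _, ?_, ?_⟩
  · rintro e (⟨he, heC⟩ | ⟨he, heC⟩) e' (⟨he', heC'⟩ | ⟨he', heC'⟩) h
    · exact hFα.injOn he he' h
    · exact absurd (h ▸ heC) heC'
    · exact absurd (h.symm ▸ heC') heC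
    · exact hGα he he' h
  · intro x _
    by_cases hx : x ∈ C
    · obtain ⟨e, he, rfl⟩ := hFα.surjOn (mem_univ x)
      exact ⟨e, Or.inl ⟨he, hx⟩, rfl⟩
    · have : x ∈ α '' G := by
        by_contra hxG
        exact hx (mem_iUnion.2 ⟨0, hxG⟩)
      obtain ⟨e, he, rfl⟩ := this
      exact ⟨e, Or.inr ⟨he, hx⟩, rfl⟩
  · rintro e (⟨he, heC⟩ | ⟨he, heC⟩) e' (⟨he', heC'⟩ | ⟨he', heC'⟩) h
    · exact hFβ he he' h
    · exact absurd (hCF e he e' he' h heC) heC'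
    · exact absurd (hCF e' he' e he h.symm heC') heC
    · exact hGβ.injOn he he' h
  · intro y _
    obtain ⟨e', he', rfl⟩ := hGβ.surjOn (mem_univ y)
    by_cases hx : α e' ∈ C
    · obtain ⟨e, he, heC, h⟩ := hCG e' he' hx
      exact ⟨e, Or.inl ⟨he, heC⟩, h⟩
    · exact ⟨e', Or.inr ⟨he', hx⟩, rfl⟩

/-- An open correspondence embedding `A × ℕ` into `B × ℕ` with closed image and raising levels: the
sources `a (V k)` of countably many compact open partial matchings partition `A`, and the `k`-th
matching is used to send level `m` into level `Nat.pair m k + 1`. -/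
theorem exists_isOpen_stable_embedding {E A B : Type*} [TopologicalSpace E] [TopologicalSpace A]
    [TopologicalSpace B] [PrespectralSpace E] [T2Space A] [T2Space B] [SigmaCompactSpace A]
    {a : E → A} {b : E → B} (ha : IsLocalHomeomorph a) (hb : IsLocalHomeomorph b)
    (has : Function.Surjective a) :
    ∃ F : Set (E × ℕ × ℕ), IsOpen F ∧ BijOn (fun e => (a e.1, e.2.1)) F univ ∧
      InjOn (fun e => (b e.1, e.2.2)) F ∧ IsClosed ((fun e => (b e.1, e.2.2)) '' F) ∧
      ∀ e ∈ F, e.2.1 < e.2.2 := by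
  obtain ⟨V, hVo, hVc, hVa, hVb, hV⟩ := exists_countable_compactOpen_cover ha hb ha.isOpenMap has
  let R : ℕ → Set A := fun k => ⋃ j ∈ Finset.range k, a '' V j
  have hR : ∀ k, IsClopen (R k) := fun k =>
    ⟨isClosed_biUnion_finset fun j _ => ((hVc j).image ha.continuous).isClosed,
      isOpen_biUnion fun j _ => ha.isOpenMap _ (hVo j)⟩
  let W : ℕ → Set E := fun k => V k ∩ a ⁻¹' (R k)ᶜ
  have hWo : ∀ k, IsOpen (W k) := fun k =>
    (hVo k).inter ((hR k).compl.isOpen.preimage ha.continuous)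
  have hWc : ∀ k, IsClosed (b '' W k) := fun k =>
    (((hVc k).inter_right ((hR k).compl.isClosed.preimage ha.continuous)).image
      hb.continuous).isClosed
  have hWex : ∀ x, ∃ k, x ∈ a '' W k := by
    intro x
    classical
    obtain ⟨e, he, rfl⟩ := Nat.find_spec (hV x)
    refine ⟨_, e, ⟨he, ?_⟩, rfl⟩
    intro hx
    obtain ⟨j, hj, hx⟩ := mem_iUnion₂.1 hx
    exact Nat.find_min (hV (a e)) (Finset.mem_range.1 hj) hx
  have hWlt : ∀ j k, ∀ e ∈ W j, ∀ e' ∈ W k, a e = a e' → ¬ j < k := by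
    intro j k e he e' he' h hjk
    exact he'.2 (mem_iUnion₂.2 ⟨j, Finset.mem_range.2 hjk, e, he.1, h⟩)
  have hWuniq : ∀ j k, ∀ e ∈ W j, ∀ e' ∈ W k, a e = a e' → j = k := by
    intro j k e he e' he' h
    have h1 := hWlt j k e he e' he' h
    have h2 := hWlt k j e' he' e he h.symm
    omega
  refine ⟨{e | ∃ k, e.1 ∈ W k ∧ e.2.2 = Nat.pair e.2.1 k + 1}, ?_, ⟨mapsTo_univ _ _, ?_, ?_⟩,
    ?_, ?_, ?_⟩
  · simp only [ofPred_exists]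
    refine isOpen_iUnion fun k => ((hWo k).preimage continuous_fst).inter ?_
    exact (isOpen_discrete {p : ℕ × ℕ | p.2 = Nat.pair p.1 k + 1}).preimage continuous_snd
  · rintro ⟨e, m, n⟩ ⟨k, he, hn⟩ ⟨e', m', n'⟩ ⟨k', he', hn'⟩ h
    obtain ⟨h1, h2⟩ := Prod.ext_iff.1 h
    dsimp only at *
    obtain rfl := hWuniq k k' e he e' he' h1
    obtain rfl := hVa k he.1 he'.1 h1
    subst h2
    rw [hn, hn']
  · rintro ⟨x, m⟩ _
    obtain ⟨k, e, he, rfl⟩ := hWex x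
    exact ⟨(e, m, Nat.pair m k + 1), ⟨k, he, rfl⟩, rfl⟩
  · rintro ⟨e, m, n⟩ ⟨k, he, hn⟩ ⟨e', m', n'⟩ ⟨k', he', hn'⟩ h
    obtain ⟨h1, h2⟩ := Prod.ext_iff.1 h
    dsimp only at *
    subst h2
    obtain ⟨rfl, rfl⟩ := Nat.pair_eq_pair.1 (Nat.succ_injective (hn.symm.trans hn'))
    obtain rfl := hVb k he.1 he'.1 h1
    rfl
  · have : ((fun e : E × ℕ × ℕ => (b e.1, e.2.2)) ''
        {e | ∃ k, e.1 ∈ W k ∧ e.2.2 = Nat.pair e.2.1 k + 1})ᶜ =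
        ⋃ n, (if n = 0 then univ else (b '' W (Nat.unpair (n - 1)).2)ᶜ) ×ˢ ({n} : Set ℕ) := by
      ext ⟨y, n⟩
      simp only [mem_compl_iff, mem_image, mem_ofPred_eq, mem_iUnion, mem_prod, mem_singleton_iff]
      constructor
      · intro h
        refine ⟨n, ?_, rfl⟩
        split_ifs with h0
        · trivial
        · rintro ⟨e, he, rfl⟩
          refine h ⟨(e, (Nat.unpair (n - 1)).1, n), ⟨_, he, ?_⟩, rfl⟩
          simp only [Nat.pair_unpair]
          omega
      · rintro ⟨_, h, rfl⟩ ⟨⟨e, m, n'⟩, ⟨k, he, hn⟩, h'⟩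
        obtain ⟨rfl, rfl⟩ := Prod.ext_iff.1 h'
        dsimp only at *
        rw [if_neg (by omega), hn] at h
        simp only [Nat.add_sub_cancel, Nat.unpair_pair] at h
        exact h ⟨e, he, rfl⟩
    rw [← isOpen_compl_iff, this]
    refine isOpen_iUnion fun n => IsOpen.prod ?_ (isOpen_discrete _)
    split_ifs
    · exact isOpen_univ
    · exact (hWc _).isOpen_compl
  · rintro ⟨e, m, n⟩ ⟨k, he, hn⟩
    dsimp only at *
    have := Nat.left_le_pair m k
    omega

theorem exists_homeomorph_of_bijOn {P A : Type*} [TopologicalSpace P] [TopologicalSpace A]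
    {f : P → A} (hf : Continuous f) (hfo : IsOpenMap f) {S : Set P} (hS : IsOpen S)
    (h : BijOn f S univ) : ∃ e : S ≃ₜ A, ∀ x, e x = f x.1 := by
  have hb : Function.Bijective fun x : S => f x.1 :=
    ⟨fun x y hxy => Subtype.ext (h.injOn x.2 y.2 hxy), fun y => by
      obtain ⟨x, hx, rfl⟩ := h.surjOn (mem_univ y)
      exact ⟨⟨x, hx⟩, rfl⟩⟩
  exact ⟨(Equiv.ofBijective _ hb).toHomeomorphOfContinuousOpen (hf.comp continuous_subtype_val)
    (hfo.comp hS.isOpenMap_subtype_val), fun _ => rfl⟩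

/-- If `E` is a correspondence between `A` and `B` through surjective local homeomorphisms,
then `A × ℕ` and `B × ℕ` are matched by an open part of `E × ℕ × ℕ`. -/
theorem exists_stable_matching {E A B : Type*} [TopologicalSpace E] [TopologicalSpace A]
    [TopologicalSpace B] [PrespectralSpace E] [T2Space A] [T2Space B] [SigmaCompactSpace A]
    [SigmaCompactSpace B] {a : E → A} {b : E → B} (ha : IsLocalHomeomorph a)
    (hb : IsLocalHomeomorph b) (has : Function.Surjective a) (hbs : Function.Surjective b) :
    ∃ (S : Set (E × ℕ × ℕ)) (e : S ≃ₜ A × ℕ) (e' : S ≃ₜ B × ℕ),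
      (∀ x, (e x).1 = a x.1.1) ∧ ∀ x, (e' x).1 = b x.1.1 := by
  obtain ⟨F, hFo, hFa, hFb, hFc, hFl⟩ := exists_isOpen_stable_embedding ha hb has
  obtain ⟨G, hGo, hGb, hGa, hGc, hGl⟩ := exists_isOpen_stable_embedding hb ha hbs
  let w : E × ℕ × ℕ → E × ℕ × ℕ := fun e => (e.1, e.2.2, e.2.1)
  have hw : Continuous w := by fun_prop
  have hww : ∀ e, w (w e) = e := fun e => rfl
  have hwi : Function.Injective w := Function.LeftInverse.injective hww
  have hwG : w '' (w ⁻¹' G) = G := image_preimage_eq G fun e => ⟨w e, rfl⟩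
  have hα : Continuous fun e : E × ℕ × ℕ => (a e.1, e.2.1) :=
    (ha.continuous.comp continuous_fst).prodMk (by fun_prop)
  have hαo : IsOpenMap fun e : E × ℕ × ℕ => (a e.1, e.2.1) :=
    ha.isOpenMap.prodMap (isOpenMap_fst (X := ℕ) (Y := ℕ))
  have hβ : Continuous fun e : E × ℕ × ℕ => (b e.1, e.2.2) :=
    (hb.continuous.comp continuous_fst).prodMk (by fun_prop)
  have hβo : IsOpenMap fun e : E × ℕ × ℕ => (b e.1, e.2.2) :=
    hb.isOpenMap.prodMap (isOpenMap_snd (X := ℕ) (Y := ℕ))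
  obtain ⟨S, hS, hSα, hSβ⟩ : ∃ S : Set (E × ℕ × ℕ), IsOpen S ∧
      BijOn (fun e => (a e.1, e.2.1)) S univ ∧ BijOn (fun e => (b e.1, e.2.2)) S univ := by
    refine exists_isOpen_bijOn_of_levels (F := F) (G := w ⁻¹' G) (ℓ := Prod.snd) hα hαo hβ hβo
      hFo (hGo.preimage hw) hFa hFb hFc ⟨mapsTo_univ _ _, ?_, ?_⟩ ?_ ?_ continuous_snd ?_
    · exact fun e he e' he' h => hwi (hGb.injOn he he' h)
    · intro y hy
      obtain ⟨e, he, rfl⟩ := hGb.surjOn hy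
      exact ⟨w e, he, rfl⟩
    · exact fun e he e' he' h => hwi (hGa he he' h)
    · rw [← hwG, ← image_comp] at hGc
      exact hGc
    · intro e he e' he' h
      have h1 := hFl e he
      have h2 := hGl _ he'
      have h3 := congrArg Prod.snd h
      dsimp only [w] at *
      omega
  obtain ⟨e, he⟩ := exists_homeomorph_of_bijOn hα hαo hS hSα
  obtain ⟨e', he'⟩ := exists_homeomorph_of_bijOn hβ hβo hS hSβ
  exact ⟨S, e, e', fun x => by rw [he], fun x => by rw [he']⟩

theorem injOn_iUnion_of_ne_earlier {E D : Type*} {c : E → D} {W S : ℕ → Set E}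
    (hSW : ∀ k, S k ⊆ W k) (hc : ∀ k, InjOn c (W k))
    (hne : ∀ j k, j < k → ∀ e ∈ S k, ∀ e' ∈ W j, c e ≠ c e') : InjOn c (⋃ k, S k) := by
  intro e he e' he' h
  obtain ⟨j, hj⟩ := mem_iUnion.1 he
  obtain ⟨k, hk⟩ := mem_iUnion.1 he'
  rcases lt_trichotomy j k with hjk | rfl | hjk
  · exact absurd h.symm (hne j k hjk e' hk e (hSW j hj))
  · exact hc _ (hSW _ hj) (hSW _ hk) h
  · exact absurd h (hne k j hjk e hj e' (hSW k hk))

theorem isClopen_image_iUnion_of_ne_earlier {E D : Type*} [TopologicalSpace E] [TopologicalSpace D]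
    [T2Space D] {c : E → D} {W S : ℕ → Set E} (hc : IsLocalHomeomorph c)
    (hcs : Function.Surjective c) (hW : ∀ e, ∃ k, e ∈ W k) (hWo : ∀ k, IsOpen (W k))
    (hSo : ∀ k, IsOpen (S k)) (hSc : ∀ k, IsCompact (S k))
    (hne : ∀ j k, j < k → ∀ e ∈ S k, ∀ e' ∈ W j, c e ≠ c e') : IsClopen (c '' ⋃ k, S k) := by
  refine ⟨?_, hc.isOpenMap _ (isOpen_iUnion hSo)⟩
  rw [image_iUnion]
  refine LocallyFinite.isClosed_iUnion (fun x => ?_)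
    fun k => ((hSc k).image hc.continuous).isClosed
  obtain ⟨e, rfl⟩ := hcs x
  obtain ⟨j, hj⟩ := hW e
  refine ⟨c '' W j, (hc.isOpenMap _ (hWo j)).mem_nhds ⟨e, hj, rfl⟩, (finite_Iic j).subset ?_⟩
  rintro k ⟨_, ⟨e', he', rfl⟩, e'', he'', h⟩
  by_contra hjk
  exact hne j k (not_le.1 hjk) e' he' e'' he'' h.symm

/-- An open set `S` of a correspondence matching a clopen part of `A` with a clopen part of `B`,
such that every point of `E` is linked to a point of `S`. With `W k` compact open partial matchings
covering `E`, `S` consists of the points of the `W k` lying over no earlier `a (W j)` or `b (W j)`;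
hence only the first `j + 1` pieces of `S` meet `a (W j)`, which makes `a (S)` closed. -/
theorem exists_isOpen_clopen_matching {E A B : Type*} [TopologicalSpace E] [TopologicalSpace A]
    [TopologicalSpace B] [PrespectralSpace E] [SigmaCompactSpace E] [T2Space A] [T2Space B]
    {a : E → A} {b : E → B} (ha : IsLocalHomeomorph a)
    (hb : IsLocalHomeomorph b) (has : Function.Surjective a) (hbs : Function.Surjective b) :
    ∃ S : Set E, IsOpen S ∧ InjOn a S ∧ InjOn b S ∧ IsClopen (a '' S) ∧ IsClopen (b '' S) ∧
      ∀ e, ∃ e' ∈ S, Relation.ReflTransGen (fun x y => a x = a y ∨ b x = b y) e e' := by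
  obtain ⟨W, hWo, hWc, hWa, hWb, hW⟩ :=
    exists_countable_compactOpen_cover ha hb IsOpenMap.id (Function.surjective_id (α := E))
  simp only [image_id] at hW
  let R : ℕ → Set E := fun k => ⋃ j ∈ Finset.range k, W j
  have hRc : ∀ k, IsCompact (R k) := fun k =>
    (Finset.range k).isCompact_biUnion fun j _ => hWc j
  have hRo : ∀ k, IsOpen (R k) := fun k => isOpen_biUnion fun j _ => hWo j
  let S : ℕ → Set E := fun k => W k ∩ (a ⁻¹' (a '' R k)ᶜ ∩ b ⁻¹' (b '' R k)ᶜ)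
  have hcl : ∀ k, IsClopen (a ⁻¹' (a '' R k)ᶜ ∩ b ⁻¹' (b '' R k)ᶜ) := fun k =>
    ((show IsClopen (a '' R k) from ⟨((hRc k).image ha.continuous).isClosed,
      ha.isOpenMap _ (hRo k)⟩).compl.preimage ha.continuous).inter
    ((show IsClopen (b '' R k) from ⟨((hRc k).image hb.continuous).isClosed,
      hb.isOpenMap _ (hRo k)⟩).compl.preimage hb.continuous)
  have hSo : ∀ k, IsOpen (S k) := fun k => (hWo k).inter (hcl k).isOpen
  have hSc : ∀ k, IsCompact (S k) := fun k => (hWc k).inter_right (hcl k).isClosed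
  have hWR : ∀ {j k}, j < k → W j ⊆ R k := fun hjk e he =>
    mem_iUnion₂.2 ⟨_, Finset.mem_range.2 hjk, he⟩
  have hSa : ∀ j k, j < k → ∀ e ∈ S k, ∀ e' ∈ W j, a e ≠ a e' :=
    fun j k hjk e he e' he' h => he.2.1 ⟨e', hWR hjk he', h.symm⟩
  have hSb : ∀ j k, j < k → ∀ e ∈ S k, ∀ e' ∈ W j, b e ≠ b e' :=
    fun j k hjk e he e' he' h => he.2.2 ⟨e', hWR hjk he', h.symm⟩
  have hSW : ∀ k, S k ⊆ W k := fun k => inter_subset_left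
  refine ⟨⋃ k, S k, isOpen_iUnion hSo, injOn_iUnion_of_ne_earlier hSW hWa hSa,
    injOn_iUnion_of_ne_earlier hSW hWb hSb,
    isClopen_image_iUnion_of_ne_earlier ha has hW hWo hSo hSc hSa,
    isClopen_image_iUnion_of_ne_earlier hb hbs hW hWo hSo hSc hSb, ?_⟩
  have main : ∀ k, ∀ e ∈ W k, ∃ e' ∈ ⋃ k, S k,
      Relation.ReflTransGen (fun x y => a x = a y ∨ b x = b y) e e' := by
    intro k
    induction k using Nat.strong_induction_on with
    | _ k ih =>
      intro e he
      by_cases hS : e ∈ S k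
      · exact ⟨e, mem_iUnion.2 ⟨k, hS⟩, .refl⟩
      · have : ∃ e'' ∈ R k, a e = a e'' ∨ b e = b e'' := by
          by_contra! hno
          refine hS ⟨he, ?_, ?_⟩
          · rintro ⟨e'', he'', h⟩; exact (hno e'' he'').1 h.symm
          · rintro ⟨e'', he'', h⟩; exact (hno e'' he'').2 h.symm
        obtain ⟨e'', he'', h⟩ := this
        obtain ⟨j, hj, hej⟩ := mem_iUnion₂.1 he''
        obtain ⟨e', he', hr⟩ := ih j (Finset.mem_range.1 hj) e'' hej
        exact ⟨e', he', hr.head h⟩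
  intro e
  obtain ⟨k, hk⟩ := hW e
  exact main k e hk

end Matching

/-! ### Calculus in groupoids -/

section Algebra

attribute [simp] ArrowGroupoid.rng_rng ArrowGroupoid.src_rng ArrowGroupoid.rng_src
  ArrowGroupoid.src_src ArrowGroupoid.rng_mul ArrowGroupoid.src_mul ArrowGroupoid.rng_mul_self
  ArrowGroupoid.mul_src_self ArrowGroupoid.rng_inv ArrowGroupoid.src_inv ArrowGroupoid.comp_inv
  ArrowGroupoid.inv_comp

variable {G : Type*} {H : Type*} {K : Type*} [ArrowGroupoid G] [ArrowGroupoid H] [ArrowGroupoid K]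

@[simp] theorem rng_unit (x : unitSpace G) : rng x.1 = x.1 := x.2

@[simp] theorem src_unit (x : unitSpace G) : src x.1 = x.1 := by
  rw [← rng_unit x, src_rng]

@[simp] theorem r_coe (g : G) : (r g : G) = rng g := rfl

@[simp] theorem s_coe (g : G) : (s g : G) = src g := rfl

@[simp] theorem r_unit (x : unitSpace G) : r x.1 = x := Subtype.ext (rng_unit x)

@[simp] theorem s_unit (x : unitSpace G) : s x.1 = x := Subtype.ext (src_unit x)

@[simp] theorem r_mul (g h : G) (p) : r (mul g h p) = r g := Subtype.ext (rng_mul g h p)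

@[simp] theorem s_mul (g h : G) (p) : s (mul g h p) = s h := Subtype.ext (src_mul g h p)

@[simp] theorem r_inv (g : G) : r (inv g) = s g := Subtype.ext (rng_inv g)

@[simp] theorem s_inv (g : G) : s (inv g) = r g := Subtype.ext (src_inv g)

@[simp] theorem r_rng (g : G) : r (rng g) = r g := Subtype.ext (rng_rng g)

@[simp] theorem s_src (g : G) : s (src g) = s g := Subtype.ext (src_src g)

theorem s_eq_r_iff {g h : G} : s g = r h ↔ src g = rng h := Subtype.ext_iff

theorem mul_congr {g g' h h' : G} (hg : g = g') (hh : h = h') (p : src g = rng h) :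
    mul g h p = mul g' h' (hg ▸ hh ▸ p) := by
  subst hg hh; rfl

@[simp] theorem mul_assoc_right (g h k : G) (p : src g = rng h) (q : src (mul g h p) = rng k) :
    mul (mul g h p) k q =
      mul g (mul h k ((src_mul g h p).symm.trans q)) (p.trans (rng_mul h k _).symm) :=
  comp_assoc g h k p _

theorem unit_mul (u g : G) (hu : u = rng g) (p : src u = rng g) : mul u g p = g := by
  subst hu; exact rng_mul_self g

theorem mul_unit (u g : G) (hu : u = src g) (p : src g = rng u) : mul g u p = g := by
  subst hu; exact mul_src_self g

@[simp] theorem inv_mul_cancel_left (g h : G) (p : src g = rng h)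
    (q : src (inv g) = rng (mul g h p)) : mul (inv g) (mul g h p) q = h := by
  rw [← comp_assoc (inv g) g h (src_inv g) p, mul_congr (inv_comp g) rfl]
  exact unit_mul _ _ p _

@[simp] theorem mul_inv_cancel_left (g h : G) (p : src (inv g) = rng h)
    (q : src g = rng (mul (inv g) h p)) : mul g (mul (inv g) h p) q = h := by
  rw [← comp_assoc g (inv g) h (rng_inv g).symm p, mul_congr (comp_inv g) rfl]
  exact unit_mul _ _ ((src_inv g).symm.trans p) _

theorem mul_left_cancel {g h k : G} {p : src g = rng h} {q : src g = rng k}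
    (e : mul g h p = mul g k q) : h = k := by
  have h1 := inv_mul_cancel_left g h p (by simp)
  have h2 := inv_mul_cancel_left g k q (by simp)
  rw [← h1, ← h2]
  exact mul_congr rfl e _

theorem mul_right_cancel {g h k : G} {p : src h = rng g} {q : src k = rng g}
    (e : mul h g p = mul k g q) : h = k := by
  have h1 : mul (mul h g p) (inv g) (by simp) = h := by
    rw [mul_assoc_right, mul_congr rfl (comp_inv g)]
    exact mul_unit _ _ p.symm _
  have h2 : mul (mul k g q) (inv g) (by simp) = k := by
    rw [mul_assoc_right, mul_congr rfl (comp_inv g)]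
    exact mul_unit _ _ q.symm _
  rw [← h1, ← h2]
  exact mul_congr e rfl _

theorem eq_inv_of_mul_eq {g h : G} {p : src g = rng h} (e : mul g h p = rng g) : h = inv g :=
  mul_left_cancel (p := p) (q := (rng_inv g).symm) (e.trans (comp_inv g).symm)

@[simp] theorem inv_inv (g : G) : inv (inv g) = g :=
  (eq_inv_of_mul_eq (p := src_inv g) ((inv_comp g).trans (rng_inv g).symm)).symm

theorem eq_rng_of_mul_self {g : G} {p : src g = rng g} (e : mul g g p = g) : g = rng g := by
  refine mul_left_cancel (g := g) (p := p) (q := by simp [p]) (e.trans ?_)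
  exact (mul_unit _ _ p.symm _).symm

/-- A map preserving composability and products is a homomorphism: units are the idempotents. -/
theorem IsHom.of_mul {φ : G → H} (hc : ∀ g h, src g = rng h → src (φ g) = rng (φ h))
    (hm : ∀ g h (p : src g = rng h), φ (mul g h p) = mul (φ g) (φ h) (hc g h p)) : IsHom φ where
  map_rng g := by
    have h1 := hm (rng g) (rng g) (by simp)
    have h2 := hm (rng g) g (by simp)
    rw [unit_mul _ _ (by simp)] at h1 h2
    rw [eq_rng_of_mul_self h1.symm, ← rng_mul _ _ (hc _ g (by simp)), ← h2]
  map_src g := by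
    have h1 := hm (src g) (src g) (by simp)
    have h2 := hm g (src g) (by simp)
    rw [unit_mul _ _ (by simp)] at h1
    rw [mul_unit _ _ rfl] at h2
    have h3 := eq_rng_of_mul_self h1.symm
    calc φ (src g) = src (φ (src g)) := by rw [h3]; simp
      _ = src (mul (φ g) (φ (src g)) (hc g _ (by simp))) := (src_mul _ _ _).symm
      _ = src (φ g) := by rw [← h2]
  map_mul g h p _ := hm g h p

theorem IsHom.comp {φ : G → H} {ψ : H → K} (hψ : IsHom ψ) (hφ : IsHom φ) : IsHom (ψ ∘ φ) where
  map_rng g := by simp [hφ.map_rng, hψ.map_rng]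
  map_src g := by simp [hφ.map_src, hψ.map_src]
  map_mul g h p q := by
    have p' : src (φ g) = rng (φ h) := by rw [← hφ.map_src, ← hφ.map_rng, p]
    simp only [Function.comp_apply, hφ.map_mul g h p p']
    exact hψ.map_mul _ _ _ _

theorem IsHom.composable {φ : G → H} (hφ : IsHom φ) {g h : G} (p : src g = rng h) :
    src (φ g) = rng (φ h) := by
  rw [← hφ.map_src, ← hφ.map_rng, p]

theorem IsHom.symm {Φ : G ≃ H} (h : IsHom Φ) : IsHom Φ.symm := by
  have hc : ∀ g k, src g = rng k → src (Φ.symm g) = rng (Φ.symm k) := fun g k p =>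
    Φ.injective (by rw [h.map_src, h.map_rng]; simpa using p)
  refine IsHom.of_mul hc fun g k p => Φ.injective ?_
  rw [h.map_mul _ _ (hc g k p) (h.composable (hc g k p)), Φ.apply_symm_apply]
  exact mul_congr (Φ.apply_symm_apply g).symm (Φ.apply_symm_apply k).symm _

theorem IsHom.onUnits_r {φ : G → H} (hφ : IsHom φ) (g : G) : hφ.onUnits (r g) = r (φ g) :=
  Subtype.ext (hφ.map_rng g)

theorem IsHom.onUnits_s {φ : G → H} (hφ : IsHom φ) (g : G) : hφ.onUnits (s g) = s (φ g) :=
  Subtype.ext (hφ.map_src g)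

end Algebra

section TopologicalCalculus

variable {G : Type*} {H : Type*} {K : Type*} [ArrowGroupoid G] [ArrowGroupoid H] [ArrowGroupoid K]
  [TopologicalSpace G] [TopologicalSpace H] [TopologicalSpace K]

theorem IsHom.continuous_onUnits {φ : G → H} (hφ : IsHom φ) (hc : Continuous φ) :
    Continuous hφ.onUnits :=
  (hc.comp continuous_subtype_val).subtype_mk _

theorem IsTopological.continuous_r (hG : IsTopological G) : Continuous (r : G → unitSpace G) :=
  hG.continuous_rng.subtype_mk _

theorem IsTopological.continuous_s (hG : IsTopological G) : Continuous (s : G → unitSpace G) :=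
  hG.continuous_src.subtype_mk _

theorem IsTopological.continuous_mul' (hG : IsTopological G) {X : Type*} [TopologicalSpace X]
    {f g : X → G} (hf : Continuous f) (hg : Continuous g) (p : ∀ x, src (f x) = rng (g x)) :
    Continuous fun x => mul (f x) (g x) (p x) :=
  hG.continuous_mul.comp ((hf.prodMk hg).subtype_mk p)

theorem Isomorphic.symm (h : Isomorphic G H) : Isomorphic H G := by
  obtain ⟨Φ, hΦ⟩ := h
  exact ⟨Φ.symm, IsHom.symm (Φ := Φ.toEquiv) hΦ⟩

theorem Isomorphic.trans (h : Isomorphic G H) (h' : Isomorphic H K) : Isomorphic G K := by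
  obtain ⟨Φ, hΦ⟩ := h
  obtain ⟨Ψ, hΨ⟩ := h'
  exact ⟨Φ.trans Ψ, hΨ.comp hΦ⟩

end TopologicalCalculus

/-! ### Ampliations -/

section Ampliation

variable {G : Type*} {H : Type*} {K : Type*} [ArrowGroupoid G] [ArrowGroupoid H] [ArrowGroupoid K]
variable {X Y T : Type*} {φ : X → unitSpace G} {ψ : Y → unitSpace H}

/-- The element `(x, g, y)` of the ampliation along `φ`. -/
abbrev Ampliation.mk (φ : X → unitSpace G) (x : X) (g : G) (y : X) (h : φ x = r g ∧ φ y = s g) :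
    Ampliation φ :=
  ⟨(x, g, y), h⟩

theorem Ampliation.ext {a b : Ampliation φ} (h1 : a.1.1 = b.1.1) (h2 : a.1.2.1 = b.1.2.1)
    (h3 : a.1.2.2 = b.1.2.2) : a = b :=
  Subtype.ext (Prod.ext h1 (Prod.ext h2 h3))

theorem Ampliation.src_eq_rng_iff {a b : Ampliation φ} : src a = rng b ↔ a.1.2.2 = b.1.1 := by
  refine ⟨fun h => congrArg (fun c : Ampliation φ => c.1.1) h, fun h => Ampliation.ext h ?_ h⟩
  change src a.1.2.1 = rng b.1.2.1
  have h1 := a.2.2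
  have h2 := b.2.1
  rw [h] at h1
  exact Subtype.ext_iff.1 (h1.symm.trans h2)

/-- The unit of the ampliation at a point. -/
def Ampliation.unit (φ : X → unitSpace G) (x : X) : unitSpace (Ampliation φ) :=
  ⟨.mk φ x (φ x).1 x (by simp), Ampliation.ext rfl (rng_unit _) rfl⟩

theorem Ampliation.unit_fst (u : unitSpace (Ampliation φ)) : Ampliation.unit φ u.1.1.1 = u := by
  have h : rng u.1 = u.1 := u.2
  refine Subtype.ext (Ampliation.ext rfl ?_ ?_)
  · have h1 : rng u.1.1.2.1 = u.1.1.2.1 := congrArg (fun c : Ampliation φ => c.1.2.1) h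
    change (φ u.1.1.1).1 = u.1.1.2.1
    rw [u.1.2.1, r_coe, h1]
  · have h3 : (rng u.1).1.2.2 = u.1.1.2.2 := by rw [h]
    exact h3

theorem Ampliation.r_eq (a : Ampliation φ) : r a = Ampliation.unit φ a.1.1 :=
  (Ampliation.unit_fst (r a)).symm

theorem Ampliation.s_eq (a : Ampliation φ) : s a = Ampliation.unit φ a.1.2.2 :=
  (Ampliation.unit_fst (s a)).symm

theorem Ampliation.isHom_mid : IsHom fun a : Ampliation φ => a.1.2.1 where
  map_rng _ := rfl
  map_src _ := rfl
  map_mul _ _ _ _ := rfl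

/-- A map into an ampliation preserving end points, whose middle component is multiplicative, is a
homomorphism. -/
theorem Ampliation.isHom_of_mul {Φ : K → Ampliation ψ} {f : unitSpace K → Y}
    (h1 : ∀ k, (Φ k).1.1 = f (r k)) (h3 : ∀ k, (Φ k).1.2.2 = f (s k))
    (hm : ∀ g h (p : src g = rng h) (q : src (Φ g).1.2.1 = rng (Φ h).1.2.1),
      (Φ (mul g h p)).1.2.1 = mul (Φ g).1.2.1 (Φ h).1.2.1 q) : IsHom Φ := by
  have hc : ∀ g h, src g = rng h → src (Φ g) = rng (Φ h) := fun g h p => by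
    rw [Ampliation.src_eq_rng_iff, h1, h3, s_eq_r_iff.2 p]
  refine IsHom.of_mul hc fun g h p => Ampliation.ext ?_ (hm g h p _) ?_
  · rw [h1, r_mul, ← h1]; rfl
  · rw [h3, s_mul, ← h3]; rfl

variable [TopologicalSpace G] [TopologicalSpace H] [TopologicalSpace K]
  [TopologicalSpace X] [TopologicalSpace Y] [TopologicalSpace T]

theorem Ampliation.continuous_val : Continuous fun a : Ampliation φ => a.1 := continuous_subtype_val

theorem Ampliation.continuous_fst : Continuous fun a : Ampliation φ => a.1.1 :=
  Ampliation.continuous_val.fst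

theorem Ampliation.continuous_mid : Continuous fun a : Ampliation φ => a.1.2.1 :=
  Ampliation.continuous_val.snd.fst

theorem Ampliation.continuous_lst : Continuous fun a : Ampliation φ => a.1.2.2 :=
  Ampliation.continuous_val.snd.snd

theorem Ampliation.continuous_mk {f f' : T → X} {c : T → G} (hf : Continuous f) (hc : Continuous c)
    (hf' : Continuous f') (p : ∀ t, φ (f t) = r (c t) ∧ φ (f' t) = s (c t)) :
    Continuous fun t => Ampliation.mk φ (f t) (c t) (f' t) (p t) :=
  (hf.prodMk (hc.prodMk hf')).subtype_mk p

theorem Ampliation.isEmbedding_val : IsEmbedding fun a : Ampliation φ => a.1 :=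
  IsEmbedding.subtypeVal

/-- The unit space of the ampliation along `φ : X → G⁽⁰⁾` is `X`. -/
def Ampliation.unitsHomeo (hφ : Continuous φ) : unitSpace (Ampliation φ) ≃ₜ X where
  toFun u := u.1.1.1
  invFun := Ampliation.unit φ
  left_inv := Ampliation.unit_fst
  right_inv _ := rfl
  continuous_toFun := Ampliation.continuous_fst.comp continuous_subtype_val
  continuous_invFun := (Ampliation.continuous_mk continuous_id
    (continuous_subtype_val.comp hφ) continuous_id _).subtype_mk _

/-- The homeomorphism of base spaces induced by an isomorphism of ampliations. -/
theorem exists_base_homeo (hφ : Continuous φ) (hψ : Continuous ψ)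
    (F : Ampliation φ ≃ₜ Ampliation ψ) (hF : IsHom F) :
    ∃ F₀ : X ≃ₜ Y, ∀ a, (F a).1.1 = F₀ a.1.1 ∧ (F a).1.2.2 = F₀ a.1.2.2 := by
  have hF' : IsHom F.symm := IsHom.symm (Φ := F.toEquiv) hF
  let E : unitSpace (Ampliation φ) ≃ₜ unitSpace (Ampliation ψ) :=
    { toFun := hF.onUnits
      invFun := hF'.onUnits
      left_inv := fun x => Subtype.ext (F.symm_apply_apply x.1)
      right_inv := fun x => Subtype.ext (F.apply_symm_apply x.1)
      continuous_toFun := hF.continuous_onUnits F.continuous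
      continuous_invFun := hF'.continuous_onUnits F.symm.continuous }
  refine ⟨(Ampliation.unitsHomeo hφ).symm.trans (E.trans (Ampliation.unitsHomeo hψ)),
    fun a => ⟨?_, ?_⟩⟩
  · change _ = (hF.onUnits (Ampliation.unit φ a.1.1)).1.1.1
    rw [← Ampliation.r_eq, hF.onUnits_r]; rfl
  · change _ = (hF.onUnits (Ampliation.unit φ a.1.2.2)).1.1.1
    rw [← Ampliation.s_eq, hF.onUnits_s]; rfl

/-- Isomorphic ampliations remain isomorphic when the common base is pulled back along `j`. -/
theorem Isomorphic.ampliation_comp {F : Ampliation φ ≃ₜ Ampliation ψ} (hF : IsHom F)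
    {F₀ : X ≃ₜ Y} (h1 : ∀ a, (F a).1.1 = F₀ a.1.1) (h3 : ∀ a, (F a).1.2.2 = F₀ a.1.2.2)
    {j : T → X} (hj : Continuous j) :
    Isomorphic (Ampliation fun t => φ (j t)) (Ampliation fun t => ψ (F₀ (j t))) := by
  have k1 : ∀ b, F₀ (F.symm b).1.1 = b.1.1 := fun b => by rw [← h1, F.apply_symm_apply]
  have k3 : ∀ b, F₀ (F.symm b).1.2.2 = b.1.2.2 := fun b => by rw [← h3, F.apply_symm_apply]
  let u : Ampliation (fun t => φ (j t)) → Ampliation φ := fun a =>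
    .mk φ (j a.1.1) a.1.2.1 (j a.1.2.2) a.2
  let v : Ampliation (fun t => ψ (F₀ (j t))) → Ampliation ψ :=
    fun a => .mk ψ (F₀ (j a.1.1)) a.1.2.1 (F₀ (j a.1.2.2)) a.2
  have hu : Continuous u := Ampliation.continuous_mk (hj.comp Ampliation.continuous_fst)
    Ampliation.continuous_mid (hj.comp Ampliation.continuous_lst) _
  have hv : Continuous v := Ampliation.continuous_mk
    (F₀.continuous.comp (hj.comp Ampliation.continuous_fst))
    Ampliation.continuous_mid (F₀.continuous.comp (hj.comp Ampliation.continuous_lst)) _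
  have hfu : ∀ a, ψ (F₀ (j a.1.1)) = r (F (u a)).1.2.1 ∧
      ψ (F₀ (j a.1.2.2)) = s (F (u a)).1.2.1 := fun a => by
    have := (F (u a)).2
    rwa [h1, h3] at this
  have hfv : ∀ b, φ (j b.1.1) = r (F.symm (v b)).1.2.1 ∧
      φ (j b.1.2.2) = s (F.symm (v b)).1.2.1 := fun b => by
    have := (F.symm (v b)).2
    rwa [F₀.injective (k1 (v b)), F₀.injective (k3 (v b))] at this
  let Φ : Ampliation (fun t => φ (j t)) ≃ₜ Ampliation fun t => ψ (F₀ (j t)) :=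
    { toFun := fun a => .mk _ a.1.1 (F (u a)).1.2.1 a.1.2.2 (hfu a)
      invFun := fun b => .mk _ b.1.1 (F.symm (v b)).1.2.1 b.1.2.2 (hfv b)
      left_inv := fun a => by
        have e : v (.mk _ a.1.1 (F (u a)).1.2.1 a.1.2.2 (hfu a)) = F (u a) :=
          Ampliation.ext (h1 (u a)).symm rfl (h3 (u a)).symm
        refine Ampliation.ext rfl ?_ rfl
        change (F.symm (v _)).1.2.1 = (u a).1.2.1
        rw [e, F.symm_apply_apply]
      right_inv := fun b => by
        have e : u (.mk _ b.1.1 (F.symm (v b)).1.2.1 b.1.2.2 (hfv b)) = F.symm (v b) :=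
          Ampliation.ext (F₀.injective (k1 (v b))).symm rfl (F₀.injective (k3 (v b))).symm
        refine Ampliation.ext rfl ?_ rfl
        change (F (u _)).1.2.1 = (v b).1.2.1
        rw [e, F.apply_symm_apply]
      continuous_toFun := Ampliation.continuous_mk Ampliation.continuous_fst
        (Ampliation.continuous_mid.comp (F.continuous.comp hu)) Ampliation.continuous_lst _
      continuous_invFun := Ampliation.continuous_mk Ampliation.continuous_fst
        (Ampliation.continuous_mid.comp (F.symm.continuous.comp hv)) Ampliation.continuous_lst _ }
  refine ⟨Φ, Ampliation.isHom_of_mul (f := fun u => u.1.1.1) (fun _ => rfl) (fun _ => rfl)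
    fun g h p q => ?_⟩
  have p' : src (u g) = rng (u h) := by
    rw [Ampliation.src_eq_rng_iff]
    exact congrArg j (Ampliation.src_eq_rng_iff.1 p)
  have e : u (mul g h p) = mul (u g) (u h) p' := rfl
  change (F (u (mul g h p))).1.2.1 = _
  rw [e, hF.map_mul _ _ p' (hF.composable p')]
  rfl

instance : DiscreteTopology FullRel := ⟨rfl⟩

theorem FullRel.continuous_mk {f g : T → ℕ} (hf : Continuous f) (hg : Continuous g) :
    Continuous fun t => FullRel.mk (f t) (g t) :=
  (continuous_of_discreteTopology (f := fun p : ℕ × ℕ => FullRel.mk p.1 p.2)).comp (hf.prodMk hg)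

/-- The ampliation of `G` along the projection `G⁽⁰⁾ × ℕ → G⁽⁰⁾` is `G × 𝓡`. -/
theorem isomorphic_ampliation_prod_fullRel (hG : IsTopological G) (e : T ≃ₜ unitSpace G × ℕ) :
    Isomorphic (Ampliation fun t => (e t).1) (G × FullRel) := by
  let Φ : (Ampliation fun t => (e t).1) ≃ₜ G × FullRel :=
    { toFun := fun a => (a.1.2.1, ⟨(e a.1.1).2, (e a.1.2.2).2⟩)
      invFun := fun b => 
        .mk (fun t => (e t).1) (e.symm (r b.1, b.2.m)) b.1 (e.symm (s b.1, b.2.n)) (by simp)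
      left_inv := fun a => by
        refine Ampliation.ext (b := a) (e.injective ?_) rfl (e.injective ?_)
        · change e (e.symm (r a.1.2.1, (e a.1.1).2)) = _
          rw [e.apply_symm_apply, ← a.2.1]
        · change e (e.symm (s a.1.2.1, (e a.1.2.2).2)) = _
          rw [e.apply_symm_apply, ← a.2.2]
      right_inv := fun b => by simp
      continuous_toFun := Ampliation.continuous_mid.prodMk (FullRel.continuous_mk
        (continuous_snd.comp (e.continuous.comp Ampliation.continuous_fst))
        (continuous_snd.comp (e.continuous.comp Ampliation.continuous_lst)))
      continuous_invFun := Ampliation.continuous_mk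
        (e.symm.continuous.comp ((hG.continuous_r.comp continuous_fst).prodMk
          ((continuous_of_discreteTopology (f := FullRel.m)).comp continuous_snd)))
        continuous_fst
        (e.symm.continuous.comp ((hG.continuous_s.comp continuous_fst).prodMk
          ((continuous_of_discreteTopology (f := FullRel.n)).comp continuous_snd)))
        fun b => by simp }
  refine ⟨Φ, IsHom.of_mul (fun g h p => ?_) fun g h p => rfl⟩
  refine Prod.ext (Ampliation.isHom_mid.composable p) ?_
  have := Ampliation.src_eq_rng_iff.1 p
  change FullRel.mk (e g.1.2.2).2 (e g.1.2.2).2 = ⟨(e h.1.1).2, (e h.1.1).2⟩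
  rw [this]

end Ampliation

/-! ### Corners -/

section Corner

variable {G : Type*} {H : Type*} {K : Type*} [ArrowGroupoid G] [ArrowGroupoid H] [ArrowGroupoid K]
  [TopologicalSpace G] [TopologicalSpace H] [TopologicalSpace K]

/-- A homomorphism identifying `K` with the restriction of `G` to the set of units `X`. -/
structure IsCorner (f : K → G) (X : Set (unitSpace G)) : Prop where
  hom : IsHom f
  isEmbedding : IsEmbedding f
  mem_range : ∀ g, g ∈ range f ↔ r g ∈ X ∧ s g ∈ X

variable {X : Set (unitSpace G)} {f : K → G}

theorem IsCorner.onUnits_mem (hf : IsCorner f X) (x : unitSpace K) : hf.hom.onUnits x ∈ X := by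
  have := ((hf.mem_range (f x.1)).1 ⟨_, rfl⟩).1
  rwa [← hf.hom.onUnits_r, r_unit] at this

theorem IsCorner.exists_unit (hf : IsCorner f X) {x : unitSpace G} (hx : x ∈ X) :
    ∃ y, hf.hom.onUnits y = x := by
  obtain ⟨k, hk⟩ := (hf.mem_range x.1).2 ⟨by simpa using hx, by simpa using hx⟩
  refine ⟨r k, ?_⟩
  rw [hf.hom.onUnits_r, hk, r_unit]

theorem IsCorner.isEmbedding_onUnits (hf : IsCorner f X) : IsEmbedding hf.hom.onUnits :=
  .of_comp (hf.hom.continuous_onUnits hf.isEmbedding.continuous) continuous_subtype_val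
    (hf.isEmbedding.comp IsEmbedding.subtypeVal)

theorem IsCorner.range_onUnits (hf : IsCorner f X) : range hf.hom.onUnits = X :=
  subset_antisymm (range_subset_iff.2 hf.onUnits_mem) fun _ hx => hf.exists_unit hx

theorem isCorner_restriction (X : Set (unitSpace G)) :
    IsCorner (fun g : Restriction X => (g.1 : G)) X where
  hom := ⟨fun _ => rfl, fun _ => rfl, fun _ _ _ _ => rfl⟩
  isEmbedding := IsEmbedding.subtypeVal
  mem_range g := ⟨fun ⟨k, hk⟩ => hk ▸ k.2, fun h => ⟨⟨g, h⟩, rfl⟩⟩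

theorem IsCorner.comp_iso (hf : IsCorner f X) {Φ : H ≃ₜ K} (hΦ : IsHom Φ) :
    IsCorner (f ∘ Φ) X where
  hom := hf.hom.comp hΦ
  isEmbedding := hf.isEmbedding.comp Φ.isEmbedding
  mem_range g := by rw [← hf.mem_range, Φ.surjective.range_comp]

theorem IsCorner.isomorphic (hf : IsCorner f X) : Isomorphic (Restriction X) K := by
  let Φ : K ≃ₜ Restriction X :=
    hf.isEmbedding.toHomeomorph.trans (Homeomorph.setCongr (Set.ext hf.mem_range))
  refine Isomorphic.symm ⟨Φ, ⟨fun g => Subtype.ext (hf.hom.map_rng g),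
    fun g => Subtype.ext (hf.hom.map_src g), fun g h p q => Subtype.ext (hf.hom.map_mul g h p _)⟩⟩

/-- The ampliation along an embedding is the restriction to its range. -/
theorem isCorner_ampliation_mid {T : Type*} [TopologicalSpace T] (hG : IsTopological G)
    {t : T → unitSpace G} (ht : IsEmbedding t) :
    IsCorner (fun a : Ampliation t => a.1.2.1) (range t) where
  hom := Ampliation.isHom_mid
  isEmbedding := by
    have h : IsEmbedding fun a : Ampliation t => (r a.1.2.1, a.1.2.1, s a.1.2.1) := by
      have := (ht.prodMap (IsEmbedding.id.prodMap ht)).comp (Ampliation.isEmbedding_val (φ := t))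
      convert this using 2 with a
      exact Prod.ext a.2.1.symm (Prod.ext rfl a.2.2.symm)
    exact IsEmbedding.of_comp Ampliation.continuous_mid
      (hG.continuous_r.prodMk (continuous_id.prodMk hG.continuous_s)) h
  mem_range g := by
    refine ⟨?_, ?_⟩
    · rintro ⟨a, rfl⟩
      exact ⟨⟨_, a.2.1⟩, ⟨_, a.2.2⟩⟩
    · rintro ⟨⟨x, hx⟩, ⟨y, hy⟩⟩
      exact ⟨⟨(x, g, y), hx, hy⟩, rfl⟩

/-- Restricting the base of an ampliation along an embedding gives a corner. -/
theorem isCorner_ampliation_comp {A B : Type*} [TopologicalSpace A] [TopologicalSpace B]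
    {q : B → unitSpace G} {j : A → B} (hj : IsEmbedding j) :
    IsCorner (fun a : Ampliation (fun x => q (j x)) =>
      Ampliation.mk q (j a.1.1) a.1.2.1 (j a.1.2.2) a.2) {x | x.1.1.1 ∈ range j} where
  hom := ⟨fun _ => rfl, fun _ => rfl, fun _ _ _ _ => rfl⟩
  isEmbedding := by
    have h := (hj.prodMap (IsEmbedding.id.prodMap hj)).comp
      (Ampliation.isEmbedding_val (φ := fun x => q (j x)))
    exact IsEmbedding.of_comp (Ampliation.continuous_mk (hj.continuous.comp Ampliation.continuous_fst)
      Ampliation.continuous_mid (hj.continuous.comp Ampliation.continuous_lst) _)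
      Ampliation.continuous_val h
  mem_range g := by
    refine ⟨?_, ?_⟩
    · rintro ⟨a, rfl⟩
      exact ⟨⟨_, rfl⟩, ⟨_, rfl⟩⟩
    · obtain ⟨⟨x, g, y⟩, h⟩ := g
      rintro ⟨⟨x', rfl⟩, ⟨y', rfl⟩⟩
      exact ⟨⟨(x', g, y'), h⟩, rfl⟩

end Corner

/-! ### Isomorphic ampliations, stable isomorphism and Kakutani equivalence -/

section Orbits

variable {G : Type*} {H : Type*} [ArrowGroupoid G] [ArrowGroupoid H]

theorem orbit_trans {x y z : unitSpace G} (hy : y ∈ orbit x) (hz : z ∈ orbit y) : z ∈ orbit x := by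
  obtain ⟨g, rfl, rfl⟩ := hy
  obtain ⟨h, h1, rfl⟩ := hz
  exact ⟨mul h g (s_eq_r_iff.1 h1), by simp, by simp⟩

theorem mem_orbit_self (x : unitSpace G) : x ∈ orbit x := ⟨x.1, by simp, by simp⟩

/-- A unit arrow of `G` seen between two points of the base over it is carried to an arrow of `H`. -/
theorem mem_orbit_of_ampliation {X Y : Type*}
    {φ : X → unitSpace G} {ψ : Y → unitSpace H} {F : Ampliation φ → Ampliation ψ} {F₀ : X → Y}
    (hF₀ : ∀ a, (F a).1.1 = F₀ a.1.1 ∧ (F a).1.2.2 = F₀ a.1.2.2) {x y : X} (h : φ x = φ y) :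
    ψ (F₀ y) ∈ orbit (ψ (F₀ x)) := by
  let a : Ampliation φ := .mk φ y (φ x).1 x (by simp [h])
  refine ⟨(F a).1.2.1, ?_, ?_⟩
  · rw [← (F a).2.2, (hF₀ a).2]
  · rw [← (F a).2.1, (hF₀ a).1]

end Orbits

section Stable

variable {G : Type*} {H : Type*} [ArrowGroupoid G] [ArrowGroupoid H]
  [TopologicalSpace G] [TopologicalSpace H]

theorem IsEtale.locallyCompact_unitSpace (hG : IsEtale G) : LocallyCompactSpace (unitSpace G) :=
  have := hG.locallyCompact
  hG.isOpen_unitSpace.locallyCompactSpace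

theorem IsAmple.prespectralSpace_unitSpace (hG : IsAmple G) : PrespectralSpace (unitSpace G) :=
  have := hG.locallyCompact_unitSpace
  prespectralSpace_of_isClopen_basis hG.zeroDimensional

/-- Groupoids with isomorphic ampliations are stably isomorphic: the base `X` of the ampliations is
a correspondence between the unit spaces, so some `S ⊆ X × ℕ × ℕ` is a copy of both `G⁽⁰⁾ × ℕ` and
`H⁽⁰⁾ × ℕ`, and both stabilizations are ampliations along `S`. -/
theorem isomorphic_prod_fullRel_of_ampliation [T2Space G] [T2Space H]
    [SigmaCompactSpace (unitSpace G)] [SigmaCompactSpace (unitSpace H)] (hG : IsAmple G)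
    (hH : IsAmple H) {X Y : Type*} [TopologicalSpace X] [TopologicalSpace Y]
    {φ : X → unitSpace G} {ψ : Y → unitSpace H} (hφ : IsLocalHomeomorph φ)
    (hφs : Function.Surjective φ) (hψ : IsLocalHomeomorph ψ) (hψs : Function.Surjective ψ)
    (h : Isomorphic (Ampliation φ) (Ampliation ψ)) :
    Isomorphic (G × FullRel) (H × FullRel) := by
  obtain ⟨F, hF⟩ := h
  obtain ⟨F₀, hF₀⟩ := exists_base_homeo hφ.continuous hψ.continuous F hF
  have := hG.prespectralSpace_unitSpace
  have := prespectralSpace_of_isLocalHomeomorph hφ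
  obtain ⟨S, e, e', he, he'⟩ := exists_stable_matching hφ (hψ.comp F₀.isLocalHomeomorph) hφs
    (hψs.comp F₀.surjective)
  have hGS := isomorphic_ampliation_prod_fullRel hG.toIsTopological e
  have hHS := isomorphic_ampliation_prod_fullRel hH.toIsTopological e'
  rw [show (fun t => (e t).1) = fun t : S => φ t.1.1 from funext he] at hGS
  rw [show (fun t => (e' t).1) = fun t : S => ψ (F₀ t.1.1) from funext he'] at hHS
  exact hGS.symm.trans ((Isomorphic.ampliation_comp hF (fun a => (hF₀ a).1) (fun a => (hF₀ a).2)
    (continuous_fst.comp continuous_subtype_val)).trans hHS)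

/-- Groupoids with isomorphic ampliations along a `σ`-compact base are Kakutani equivalent: both
restrictions are ampliations along the same clopen matching `S ⊆ X`, and points of `X` over the same
unit of `G` or of `H` are joined by an arrow in both groupoids, so the images of `S` are full. -/
theorem kakutaniEquivalent_of_ampliation [T2Space G] [T2Space H] (hG : IsAmple G) (hH : IsAmple H)
    {X Y : Type*} [TopologicalSpace X] [TopologicalSpace Y] [SigmaCompactSpace X]
    {φ : X → unitSpace G} {ψ : Y → unitSpace H} (hφ : IsLocalHomeomorph φ)
    (hφs : Function.Surjective φ) (hψ : IsLocalHomeomorph ψ) (hψs : Function.Surjective ψ)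
    (h : Isomorphic (Ampliation φ) (Ampliation ψ)) : KakutaniEquivalent G H := by
  obtain ⟨F, hF⟩ := h
  obtain ⟨F₀, hF₀⟩ := exists_base_homeo hφ.continuous hψ.continuous F hF
  have hF₀' : ∀ b, (F.symm b).1.1 = F₀.symm b.1.1 ∧ (F.symm b).1.2.2 = F₀.symm b.1.2.2 := by
    intro b
    have := hF₀ (F.symm b)
    rw [F.apply_symm_apply] at this
    exact ⟨by rw [this.1, F₀.symm_apply_apply], by rw [this.2, F₀.symm_apply_apply]⟩
  have := hG.prespectralSpace_unitSpace
  have := prespectralSpace_of_isLocalHomeomorph hφ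
  have hψF := hψ.comp F₀.isLocalHomeomorph
  obtain ⟨S, hSo, hSa, hSb, hca, hcb, hlink⟩ :=
    exists_isOpen_clopen_matching hφ hψF hφs (hψs.comp F₀.surjective)
  have horb : ∀ {x y : X}, Relation.ReflTransGen
      (fun x y => φ x = φ y ∨ (ψ ∘ F₀) x = (ψ ∘ F₀) y) x y →
      φ y ∈ orbit (φ x) ∧ ψ (F₀ y) ∈ orbit (ψ (F₀ x)) := by
    intro x y hxy
    induction hxy with
    | refl => exact ⟨mem_orbit_self _, mem_orbit_self _⟩
    | tail _ h ih =>
      refine ⟨orbit_trans ih.1 ?_, orbit_trans ih.2 ?_⟩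
      · rcases h with h | h
        · rw [h]; exact mem_orbit_self _
        · have := mem_orbit_of_ampliation hF₀' h
          simpa using this
      · rcases h with h | h
        · exact mem_orbit_of_ampliation hF₀ h
        · change ψ _ = ψ _ at h
          rw [h]; exact mem_orbit_self _
  refine ⟨φ '' S, (ψ ∘ F₀) '' S, hca, fun x => ?_, hcb, fun y => ?_, ?_⟩
  · obtain ⟨e, rfl⟩ := hφs x
    obtain ⟨e', he', hr⟩ := hlink e
    exact ⟨φ e', ⟨e', he', rfl⟩, (horb hr).1⟩
  · obtain ⟨e, rfl⟩ := (hψs.comp F₀.surjective) y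
    obtain ⟨e', he', hr⟩ := hlink e
    exact ⟨_, ⟨e', he', rfl⟩, (horb hr).2⟩
  · have hval : IsLocalHomeomorph (Subtype.val : S → X) :=
      hSo.isOpenEmbedding_subtypeVal.isLocalHomeomorph
    have h1 := (isCorner_ampliation_mid hG.toIsTopological
      ((hφ.comp hval).isOpenEmbedding_of_injective hSa.injective).isEmbedding).isomorphic
    have h2 := (isCorner_ampliation_mid hH.toIsTopological
      ((hψF.comp hval).isOpenEmbedding_of_injective hSb.injective).isEmbedding).isomorphic
    rw [range_comp, Subtype.range_coe] at h1 h2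
    exact h1.trans ((Isomorphic.ampliation_comp hF (fun a => (hF₀ a).1) (fun a => (hF₀ a).2)
      continuous_subtype_val).trans h2.symm)

theorem isLocalHomeomorph_fst_of_discrete (X D : Type*) [TopologicalSpace X] [TopologicalSpace D]
    [DiscreteTopology D] : IsLocalHomeomorph (Prod.fst : X × D → X) :=
  isLocalHomeomorph_of_locallyInjective continuous_fst isOpenMap_fst fun p =>
    ⟨Prod.snd ⁻¹' {p.2}, (isOpen_discrete _).preimage continuous_snd, rfl,
      fun _ hx _ hy h => Prod.ext h (hx.trans hy.symm)⟩

theorem kakutaniEquivalent_of_isomorphic_prod_fullRel [T2Space G] [T2Space H]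
    [SigmaCompactSpace (unitSpace G)] (hG : IsAmple G) (hH : IsAmple H)
    (h : Isomorphic (G × FullRel) (H × FullRel)) : KakutaniEquivalent G H :=
  kakutaniEquivalent_of_ampliation hG hH (isLocalHomeomorph_fst_of_discrete _ _)
    (Prod.fst_surjective (α := unitSpace G) (β := ℕ)) (isLocalHomeomorph_fst_of_discrete _ _)
    (Prod.fst_surjective (α := unitSpace H) (β := ℕ))
    ((isomorphic_ampliation_prod_fullRel hG.toIsTopological (Homeomorph.refl _)).trans
      (h.trans (isomorphic_ampliation_prod_fullRel hH.toIsTopological (Homeomorph.refl _)).symm))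

theorem KakutaniEquivalent.weakly (h : KakutaniEquivalent G H) : WeaklyKakutaniEquivalent G H := by
  obtain ⟨X, Y, hX, hXf, hY, hYf, h⟩ := h
  exact ⟨X, Y, hX.isOpen, hXf, hY.isOpen, hYf, h⟩

end Stable

/-! ### Weak equivalences -/

section WeakEquivalence

variable {G : Type*} {K : Type*} [ArrowGroupoid G] [ArrowGroupoid K]
  [TopologicalSpace G] [TopologicalSpace K]

/-- The inclusion of an open full corner is a weak equivalence. -/
theorem IsCorner.isWeakEquivalence (hG : IsEtale G) {f : K → G} {X : Set (unitSpace G)}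
    (hf : IsCorner f X) (hX : IsOpen X) (hXf : IsFull X) : IsWeakEquivalence f := by
  have hu : IsOpenEmbedding hf.hom.onUnits := ⟨hf.isEmbedding_onUnits, by rwa [hf.range_onUnits]⟩
  refine ⟨hf.isEmbedding.continuous, hf.hom, ?_, ?_, ?_⟩
  · have h : IsLocalHomeomorph
        fun a : {a : unitSpace K × G // hf.hom.onUnits a.1 = r a.2} => a.1.2 :=
      isLocalHomeomorph_of_isPullback (u := fun a => a.1.1) hu.isLocalHomeomorph hG.continuous_r
        IsEmbedding.subtypeVal (fun a => a.2) fun x g h => ⟨⟨(x, g), h⟩, rfl, rfl⟩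
    exact hG.isLocalHomeomorph_s.comp h
  · intro x
    obtain ⟨_, hx, g, rfl, rfl⟩ := hXf x
    obtain ⟨y, hy⟩ := hf.exists_unit hx
    exact ⟨⟨(y, g), hy⟩, rfl⟩
  · let p : K → Ampliation hf.hom.onUnits := fun k =>
      .mk _ (r k) (f k) (s k) ⟨hf.hom.onUnits_r k, hf.hom.onUnits_s k⟩
    have hmem : ∀ a : Ampliation hf.hom.onUnits, a.1.2.1 ∈ range f := fun a =>
      (hf.mem_range _).2 ⟨a.2.1 ▸ hf.onUnits_mem _, a.2.2 ▸ hf.onUnits_mem _⟩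
    let q : Ampliation hf.hom.onUnits → K := fun a =>
      hf.isEmbedding.toHomeomorph.symm ⟨a.1.2.1, hmem a⟩
    have hq : ∀ a, f (q a) = a.1.2.1 := fun a =>
      congrArg Subtype.val (hf.isEmbedding.toHomeomorph.apply_symm_apply ⟨a.1.2.1, hmem a⟩)
    have hr : Continuous (r : K → unitSpace K) := by
      rw [hu.isInducing.continuous_iff]
      exact (hG.continuous_r.comp hf.isEmbedding.continuous).congr fun k => (hf.hom.onUnits_r k).symm
    have hs : Continuous (s : K → unitSpace K) := by
      rw [hu.isInducing.continuous_iff]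
      exact (hG.continuous_s.comp hf.isEmbedding.continuous).congr fun k => (hf.hom.onUnits_s k).symm
    let Φ : K ≃ₜ Ampliation hf.hom.onUnits :=
      { toFun := p
        invFun := q
        left_inv := fun k => hf.isEmbedding.injective (hq (p k))
        right_inv := fun a => Ampliation.ext
          (hu.injective (by
            change hf.hom.onUnits (r (q a)) = _
            rw [hf.hom.onUnits_r, hq, a.2.1]))
          (hq a)
          (hu.injective (by
            change hf.hom.onUnits (s (q a)) = _
            rw [hf.hom.onUnits_s, hq, a.2.2]))
        continuous_toFun := Ampliation.continuous_mk hr hf.isEmbedding.continuous hs _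
        continuous_invFun := hf.isEmbedding.toHomeomorph.symm.continuous.comp
          (Ampliation.continuous_mid.subtype_mk hmem) }
    exact ⟨Φ, Ampliation.isHom_of_mul (f := fun x => x) (fun _ => rfl) (fun _ => rfl)
      fun g h p q => hf.hom.map_mul g h p q, fun _ => rfl⟩

theorem isTopological_restriction (hG : IsEtale G) {X : Set (unitSpace G)} (hX : IsOpen X) :
    IsTopological (Restriction X) where
  locallyCompact := by
    have := hG.locallyCompact
    exact ((hX.preimage hG.continuous_r).inter (hX.preimage hG.continuous_s)).locallyCompactSpace
  continuous_rng := (hG.continuous_rng.comp continuous_subtype_val).subtype_mk _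
  continuous_src := (hG.continuous_src.comp continuous_subtype_val).subtype_mk _
  continuous_inv := (hG.continuous_inv.comp continuous_subtype_val).subtype_mk _
  continuous_mul := by
    have h : Continuous fun g : Restriction X => (g.1 : G) := continuous_subtype_val
    exact (hG.continuous_mul' (h.comp (continuous_fst.comp continuous_subtype_val))
      (h.comp (continuous_snd.comp continuous_subtype_val))
      fun p => congrArg Subtype.val p.2).subtype_mk _
  t2_unitSpace := by
    have := hG.t2_unitSpace
    exact T2Space.of_injective_continuous (isCorner_restriction X).isEmbedding_onUnits.injective
      (isCorner_restriction X).isEmbedding_onUnits.continuous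

theorem WeaklyKakutaniEquivalent.moritaEquivalent {G H : Type u} [ArrowGroupoid G]
    [ArrowGroupoid H] [TopologicalSpace G] [TopologicalSpace H] (hG : IsEtale G) (hH : IsEtale H)
    (h : WeaklyKakutaniEquivalent G H) : MoritaEquivalent G H := by
  obtain ⟨X, Y, hX, hXf, hY, hYf, Φ, hΦ⟩ := h
  exact ⟨Restriction X, inferInstance, inferInstance, _, _, isTopological_restriction hG hX,
    (isCorner_restriction X).isWeakEquivalence hG hX hXf,
    ((isCorner_restriction Y).comp_iso hΦ).isWeakEquivalence hH hY hYf⟩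

end WeakEquivalence

/-! ### From weak equivalences to isomorphic ampliations -/

section Morita

variable {G : Type*} {H : Type*} {K : Type*} [ArrowGroupoid G] [ArrowGroupoid H] [ArrowGroupoid K]
  [TopologicalSpace G] [TopologicalSpace H] [TopologicalSpace K]

/-- A fully faithful homomorphism `φ : K → G` identifies the ampliation of `K` along `k : X → K⁽⁰⁾`
with the ampliation of `G` along any map related to `φ ∘ k` by a continuous family `c` of arrows. -/
theorem isomorphic_ampliation_of_fullyFaithful (hG : IsTopological G) {φ : K → G} (hφ : IsHom φ)
    (hφc : Continuous φ) {Φ : K ≃ₜ Ampliation hφ.onUnits} (hΦ : ∀ k, (Φ k).1 = (r k, φ k, s k))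
    {X : Type*} [TopologicalSpace X] {k : X → unitSpace K} {c : X → G} (hk : Continuous k)
    (hc : Continuous c) (hkc : ∀ x, hφ.onUnits (k x) = r (c x)) :
    Isomorphic (Ampliation k) (Ampliation fun x => s (c x)) := by
  have hkc' : ∀ x, φ (k x).1 = rng (c x) := fun x => congrArg Subtype.val (hkc x)
  have hl : ∀ a : Ampliation k, rng (φ a.1.2.1) = rng (c a.1.1) := fun a => by
    rw [← hkc', a.2.1, r_coe, hφ.map_rng]
  have hr : ∀ a : Ampliation k, src (φ a.1.2.1) = rng (c a.1.2.2) := fun a => by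
    rw [← hkc', a.2.2, s_coe, hφ.map_src]
  have hl' : ∀ b : Ampliation (fun x => s (c x)), src (c b.1.1) = rng b.1.2.1 :=
    fun b => congrArg Subtype.val b.2.1
  have hr' : ∀ b : Ampliation (fun x => s (c x)), src b.1.2.1 = src (c b.1.2.2) :=
    fun b => (congrArg Subtype.val b.2.2).symm
  let m : Ampliation k → G := fun a => mul (inv (c a.1.1)) (mul (φ a.1.2.1) (c a.1.2.2) (hr a))
    (by simp [hl])
  let n : Ampliation (fun x => s (c x)) → G := fun b =>
    mul (c b.1.1) (mul b.1.2.1 (inv (c b.1.2.2)) (by simp [hr'])) (by simp [hl'])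
  let v : Ampliation (fun x => s (c x)) → Ampliation hφ.onUnits := fun b =>
    .mk _ (k b.1.1) (n b) (k b.1.2.2) (by simp [n, hkc])
  have hφv : ∀ b, φ (Φ.symm (v b)) = n b ∧ r (Φ.symm (v b)) = k b.1.1 ∧
      s (Φ.symm (v b)) = k b.1.2.2 := fun b => by
    have h := hΦ (Φ.symm (v b))
    rw [Φ.apply_symm_apply] at h
    exact ⟨(congrArg (fun t => t.2.1) h).symm, (congrArg (fun t => t.1) h).symm,
      (congrArg (fun t => t.2.2) h).symm⟩
  have hm : Continuous m := hG.continuous_mul'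
    (hG.continuous_inv.comp (hc.comp Ampliation.continuous_fst))
    (hG.continuous_mul' (hφc.comp Ampliation.continuous_mid) (hc.comp Ampliation.continuous_lst) _) _
  have hn : Continuous n := hG.continuous_mul' (hc.comp Ampliation.continuous_fst)
    (hG.continuous_mul' Ampliation.continuous_mid
      (hG.continuous_inv.comp (hc.comp Ampliation.continuous_lst)) _) _
  have hv : Continuous v := Ampliation.continuous_mk (hk.comp Ampliation.continuous_fst) hn
    (hk.comp Ampliation.continuous_lst) _
  have hΨ : ∀ a, s (c a.1.1) = r (m a) ∧ s (c a.1.2.2) = s (m a) := fun a => by simp [m]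
  have hΨ' : ∀ b, k b.1.1 = r (Φ.symm (v b)) ∧ k b.1.2.2 = s (Φ.symm (v b)) :=
    fun b => by simp [hφv]
  let Ψ : Ampliation k ≃ₜ Ampliation fun x => s (c x) :=
    { toFun := fun a => .mk (fun x => s (c x)) a.1.1 (m a) a.1.2.2 (hΨ a)
      invFun := fun b => .mk k b.1.1 (Φ.symm (v b)) b.1.2.2 (hΨ' b)
      left_inv := fun a => by
        refine Ampliation.ext (b := a) rfl ?_ rfl
        change Φ.symm (v _) = a.1.2.1
        rw [Homeomorph.symm_apply_eq]
        refine Subtype.ext ?_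
        rw [hΦ, ← a.2.1, ← a.2.2]
        refine Prod.ext rfl (Prod.ext ?_ rfl)
        change mul (c a.1.1) (mul (m a) (inv (c a.1.2.2)) _) _ = φ a.1.2.1
        refine mul_right_cancel (g := c a.1.2.2) (p := by simp) (q := hr a) ?_
        simp only [mul_assoc_right, m]
        have e : ∀ p, mul (inv (c a.1.2.2)) (c a.1.2.2) p = src (c a.1.2.2) :=
          fun p => inv_comp _
        simp only [e, mul_inv_cancel_left, mul_src_self]
      right_inv := fun b => by
        refine Ampliation.ext (b := b) rfl ?_ rfl
        change mul (inv (c b.1.1)) (mul (φ (Φ.symm (v b))) (c b.1.2.2) _) _ = b.1.2.1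
        simp only [(hφv b).1, n, mul_assoc_right, inv_mul_cancel_left, inv_comp]
        exact mul_unit _ _ (hr' b).symm _
      continuous_toFun := Ampliation.continuous_mk Ampliation.continuous_fst hm
        Ampliation.continuous_lst hΨ
      continuous_invFun := Ampliation.continuous_mk Ampliation.continuous_fst
        (Φ.symm.continuous.comp hv) Ampliation.continuous_lst hΨ' }
  refine ⟨Ψ, Ampliation.isHom_of_mul (f := fun u => u.1.1.1) (fun _ => rfl) (fun _ => rfl)
    fun g h p q => ?_⟩
  have e := Ampliation.src_eq_rng_iff.1 p
  have p' : src g.1.2.1 = rng h.1.2.1 := Ampliation.isHom_mid.composable p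
  change mul (inv (c g.1.1)) (mul (φ (mul g.1.2.1 h.1.2.1 p')) (c h.1.2.2) _) _ =
    mul (mul (inv (c g.1.1)) (mul (φ g.1.2.1) (c g.1.2.2) _) _)
      (mul (inv (c h.1.1)) (mul (φ h.1.2.1) (c h.1.2.2) _) _) _
  simp only [hφ.map_mul _ _ p' (hφ.composable p'), mul_assoc_right]
  simp only [e, mul_inv_cancel_left]

/-- The source map of a weak equivalence stays a surjective local homeomorphism after adjoining an
arrow of an étale groupoid `H`. The space of triples is given by `P` with its projections. -/
theorem isLocalHomeomorph_surjective_of_weakEquivalence (hH : IsEtale H) {φ : K → G}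
    {hφ : IsHom φ} {ψ₀ : unitSpace K → unitSpace H} (hψ₀ : Continuous ψ₀)
    (hl : IsLocalHomeomorph
      (fun a : {a : unitSpace K × G // hφ.onUnits a.1 = r a.2} => s a.1.2))
    (hs : Function.Surjective
      (fun a : {a : unitSpace K × G // hφ.onUnits a.1 = r a.2} => s a.1.2))
    {P : Type*} [TopologicalSpace P] {k : P → unitSpace K} {g : P → G} {h : P → H}
    (hP : IsEmbedding fun p => (k p, g p, h p))
    (hg : ∀ p, hφ.onUnits (k p) = r (g p)) (hh : ∀ p, ψ₀ (k p) = r (h p))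
    (hex : ∀ x γ η, hφ.onUnits x = r γ → ψ₀ x = r η → ∃ p, k p = x ∧ g p = γ ∧ h p = η) :
    IsLocalHomeomorph (fun p => s (g p)) ∧ Function.Surjective fun p => s (g p) := by
  have hkc : Continuous k := continuous_fst.comp hP.continuous
  have hgc : Continuous g := continuous_fst.comp (continuous_snd.comp hP.continuous)
  have hhc : Continuous h := continuous_snd.comp (continuous_snd.comp hP.continuous)
  let v : P → {a : unitSpace K × G // hφ.onUnits a.1 = r a.2} := fun p => ⟨(k p, g p), hg p⟩
  have hv : Continuous v := (hkc.prodMk hgc).subtype_mk _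
  have hbase : Continuous
      fun e : {a : unitSpace K × G // hφ.onUnits a.1 = r a.2} => ψ₀ e.1.1 :=
    hψ₀.comp (continuous_fst.comp continuous_subtype_val)
  have hvl : IsLocalHomeomorph v := by
    refine isLocalHomeomorph_of_isPullback (u := h) (f := (r : H → unitSpace H))
      (v := v) hH.isLocalHomeomorph_r
      hbase ?_ (fun p => (hh p).symm) ?_
    · refine IsEmbedding.of_comp (g := fun q => (q.2.1.1, q.2.1.2, q.1)) (hhc.prodMk hv) ?_ hP
      fun_prop
    · rintro η ⟨⟨x, γ⟩, hx⟩ e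
      obtain ⟨p, rfl, rfl, rfl⟩ := hex x γ η hx e.symm
      exact ⟨p, rfl, rfl⟩
  refine ⟨hl.comp hvl, fun x => ?_⟩
  obtain ⟨⟨⟨y, γ⟩, hy⟩, rfl⟩ := hs x
  obtain ⟨p, -, rfl, -⟩ := hex y γ (ψ₀ y).1 hy (by simp)
  exact ⟨p, rfl⟩

theorem MoritaEquivalent.haveIsomorphicAmpliations {G H : Type u} [ArrowGroupoid G]
    [ArrowGroupoid H] [TopologicalSpace G] [TopologicalSpace H] [T2Space G] [T2Space H]
    (hG : IsAmple G) (hH : IsAmple H) (h : MoritaEquivalent G H) :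
    HaveIsomorphicAmpliations G H := by
  obtain ⟨K, _, _, φ, ψ, hK, ⟨hφc, hφ, hφl, hφs, Φ, -, hΦ⟩, ⟨hψc, hψ, hψl, hψs, Ψ, -, hΨ⟩⟩ := h
  have := hK.t2_unitSpace
  let X := {a : unitSpace K × G × H // hφ.onUnits a.1 = r a.2.1 ∧ hψ.onUnits a.1 = r a.2.2}
  have hX : IsEmbedding fun a : X => (a.1.1, a.1.2.1, a.1.2.2) := IsEmbedding.subtypeVal
  have hX' : IsEmbedding fun a : X => (a.1.1, a.1.2.2, a.1.2.1) :=
    ((Homeomorph.refl (unitSpace K)).prodCongr (Homeomorph.prodComm G H)).isEmbedding.comp hX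
  obtain ⟨h1, h2⟩ := isLocalHomeomorph_surjective_of_weakEquivalence hH.toIsEtale
    (hψ.continuous_onUnits hψc) hφl hφs hX (fun p => p.2.1) (fun p => p.2.2)
    fun x γ η h h' => ⟨⟨(x, γ, η), h, h'⟩, rfl, rfl, rfl⟩
  obtain ⟨h3, h4⟩ := isLocalHomeomorph_surjective_of_weakEquivalence hG.toIsEtale
    (hφ.continuous_onUnits hφc) hψl hψs hX' (fun p => p.2.2) (fun p => p.2.1)
    fun x γ η h h' => ⟨⟨(x, η, γ), h', h⟩, rfl, rfl, rfl⟩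
  have hk : Continuous fun a : X => a.1.1 := continuous_fst.comp continuous_subtype_val
  have hXlc : LocallyCompactSpace X := by
    have := hG.prespectralSpace_unitSpace
    have := prespectralSpace_of_isLocalHomeomorph h1
    infer_instance
  exact ⟨X, X, inferInstance, inferInstance, _, _, hXlc, inferInstance, hXlc, inferInstance, h1, h2,
    h3, h4, (isomorphic_ampliation_of_fullyFaithful hG.toIsTopological hφ hφc hΦ hk
      (continuous_fst.comp (continuous_snd.comp continuous_subtype_val)) fun x => x.2.1).symm.trans
    (isomorphic_ampliation_of_fullyFaithful hH.toIsTopological hψ hψc hΨ hk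
      (continuous_snd.comp (continuous_snd.comp continuous_subtype_val)) fun x => x.2.2)⟩

end Morita

/-! ### Free and proper actions -/

section Actions

variable {G : Type*} {H : Type*} {Z : Type*} [ArrowGroupoid G] [ArrowGroupoid H]
  [TopologicalSpace G] [TopologicalSpace H] [TopologicalSpace Z]

theorem RightSpace.act_congr (B : RightSpace H Z) {z z' : Z} {h h' : H} (hz : z = z') (hh : h = h')
    (p : B.anchor z = r h) : B.act z h p = B.act z' h' (hz ▸ hh ▸ p) := by
  subst hz hh; rfl

theorem LeftSpace.act_congr (A : LeftSpace G Z) {z z' : Z} {g g' : G} (hg : g = g') (hz : z = z')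
    (p : s g = A.anchor z) : A.act g z p = A.act g' z' (hg ▸ hz ▸ p) := by
  subst hz hg; rfl

theorem RightSpace.act_of_unit (B : RightSpace H Z) {z : Z} {h : H} (hh : h = rng h)
    (p : B.anchor z = r h) : B.act z h p = z := by
  have e : h = (B.anchor z).1 := by rw [p, r_coe, ← hh]
  exact (B.act_congr rfl e p).trans (B.act_unit z _)

theorem LeftSpace.act_of_unit (A : LeftSpace G Z) {z : Z} {g : G} (hg : g = src g)
    (p : s g = A.anchor z) : A.act g z p = z := by
  have e : g = (A.anchor z).1 := by rw [← p, s_coe, ← hg]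
  exact (A.act_congr e rfl p).trans (A.unit_act z _)

theorem RightSpace.exists_act_of_quot_eq (B : RightSpace H Z) {z w : Z}
    (h : (Quot.mk _ z : B.OrbitSpace) = Quot.mk _ w) :
    ∃ (k : H) (p : B.anchor z = r k), B.act z k p = w := by
  have hg := Quot.eqvGen_exact h
  clear h
  induction hg with
  | rel x y h => exact h
  | refl x => exact ⟨(B.anchor x).1, by simp, B.act_unit x _⟩
  | symm x y _ ih =>
    obtain ⟨k, p, rfl⟩ := ih
    have q : B.anchor (B.act x k p) = r (inv k) := by rw [B.anchor_act, r_inv]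
    refine ⟨inv k, q, ?_⟩
    rw [← B.act_mul x k (inv k) (by simp) (by simp [p]) p q]
    exact B.act_of_unit (by simp) _
  | trans x y w _ _ ih ih' =>
    obtain ⟨k, p, rfl⟩ := ih
    obtain ⟨k', p', rfl⟩ := ih'
    have e : src k = rng k' := by
      rw [B.anchor_act] at p'
      exact congrArg Subtype.val p'
    exact ⟨mul k k' e, by simp [p], B.act_mul x k k' e _ p p'⟩

theorem LeftSpace.exists_act_of_quot_eq (A : LeftSpace G Z) {z w : Z}
    (h : (Quot.mk _ z : A.OrbitSpace) = Quot.mk _ w) :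
    ∃ (k : G) (p : s k = A.anchor z), A.act k z p = w := by
  have hg := Quot.eqvGen_exact h
  clear h
  induction hg with
  | rel x y h => exact h
  | refl x => exact ⟨(A.anchor x).1, by simp, A.unit_act x _⟩
  | symm x y _ ih =>
    obtain ⟨k, p, rfl⟩ := ih
    have q : s (inv k) = A.anchor (A.act k x p) := by rw [A.anchor_act, s_inv]
    refine ⟨inv k, q, ?_⟩
    rw [← A.mul_act (inv k) k x (by simp) (by simp [p]) p q]
    exact A.act_of_unit (by simp) _
  | trans x y w _ _ ih ih' =>
    obtain ⟨k, p, rfl⟩ := ih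
    obtain ⟨k', p', rfl⟩ := ih'
    have e : src k' = rng k := by
      rw [A.anchor_act] at p'
      exact congrArg Subtype.val p'
    exact ⟨mul k' k e, by simp [p], A.mul_act k' k x e _ p p'⟩

theorem RightSpace.IsFreeProper.isClosedEmbedding {B : RightSpace H Z} (hB : B.IsFreeProper) :
    IsClosedEmbedding
      fun a : {a : Z × H // B.anchor a.1 = r a.2} => (B.act a.1.1 a.1.2 a.2, a.1.1) :=
  .of_continuous_injective_isClosedMap hB.2.continuous hB.1 hB.2.isClosedMap

theorem LeftSpace.IsFreeProper.isClosedEmbedding {A : LeftSpace G Z} (hA : A.IsFreeProper) :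
    IsClosedEmbedding
      fun a : {a : G × Z // s a.1 = A.anchor a.2} => (A.act a.1.1 a.1.2 a.2, a.1.2) :=
  .of_continuous_injective_isClosedMap hA.2.continuous hA.1 hA.2.isClosedMap

theorem RightSpace.IsFreeProper.eq_of_act_eq {B : RightSpace H Z} (hB : B.IsFreeProper) {z : Z}
    {h k : H} {p q} (e : B.act z h p = B.act z k q) : h = k :=
  congrArg (fun a => a.1.2) (hB.1 (a₁ := ⟨(z, h), p⟩) (a₂ := ⟨(z, k), q⟩) (Prod.ext e rfl))

theorem LeftSpace.IsFreeProper.eq_of_act_eq {A : LeftSpace G Z} (hA : A.IsFreeProper) {z : Z}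
    {g k : G} {p q} (e : A.act g z p = A.act k z q) : g = k :=
  congrArg (fun a => a.1.1) (hA.1 (a₁ := ⟨(g, z), p⟩) (a₂ := ⟨(k, z), q⟩) (Prod.ext e rfl))

/-- The arrow translating one point of an orbit to another depends continuously on them. -/
theorem RightSpace.IsFreeProper.exists_continuous_translation {B : RightSpace H Z}
    (hB : B.IsFreeProper) {T : Type*} [TopologicalSpace T] {z w : T → Z} (hz : Continuous z)
    (hw : Continuous w) (hex : ∀ t, ∃ (h : H) (p : B.anchor (z t) = r h), B.act (z t) h p = w t) :
    ∃ c : T → H, Continuous c ∧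
      ∀ t, ∃ p : B.anchor (z t) = r (c t), B.act (z t) (c t) p = w t := by
  choose c p hc using hex
  refine ⟨c, ?_, fun t => ⟨p t, hc t⟩⟩
  have : Continuous fun t => (⟨(z t, c t), p t⟩ : {a : Z × H // B.anchor a.1 = r a.2}) := by
    rw [hB.isClosedEmbedding.isInducing.continuous_iff]
    exact (hw.prodMk hz).congr fun t => Prod.ext (hc t).symm rfl
  exact continuous_snd.comp (continuous_subtype_val.comp this)

theorem LeftSpace.IsFreeProper.exists_continuous_translation {A : LeftSpace G Z}
    (hA : A.IsFreeProper) {T : Type*} [TopologicalSpace T] {z w : T → Z} (hz : Continuous z)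
    (hw : Continuous w) (hex : ∀ t, ∃ (g : G) (p : s g = A.anchor (z t)), A.act g (z t) p = w t) :
    ∃ c : T → G, Continuous c ∧
      ∀ t, ∃ p : s (c t) = A.anchor (z t), A.act (c t) (z t) p = w t := by
  choose c p hc using hex
  refine ⟨c, ?_, fun t => ⟨p t, hc t⟩⟩
  have : Continuous fun t => (⟨(c t, z t), p t⟩ : {a : G × Z // s a.1 = A.anchor a.2}) := by
    rw [hA.isClosedEmbedding.isInducing.continuous_iff]
    exact (hw.prodMk hz).congr fun t => Prod.ext (hc t).symm rfl
  exact continuous_fst.comp (continuous_subtype_val.comp this)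

/-- A free and proper action of an étale groupoid is locally wandering: a map separating the orbits
is locally injective. -/
theorem RightSpace.IsFreeProper.isLocallyInjective {B : RightSpace H Z} (hH : IsEtale H)
    (hB : B.IsFreeProper) {W : Type*} {f : Z → W}
    (hf : ∀ z w, f z = f w → ∃ (h : H) (p : B.anchor z = r h), B.act z h p = w) :
    IsLocallyInjective f := by
  intro z
  let a₀ : {a : Z × H // B.anchor a.1 = r a.2} := ⟨(z, (B.anchor z).1), by simp⟩
  have hO : {a : {a : Z × H // B.anchor a.1 = r a.2} | a.1.2 ∈ unitSpace H} ∈ 𝓝 a₀ :=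
    (hH.isOpen_unitSpace.preimage (continuous_snd.comp continuous_subtype_val)).mem_nhds
      (B.anchor z).2
  rw [hB.isClosedEmbedding.isInducing.nhds_eq_comap, Filter.mem_comap] at hO
  obtain ⟨N, hN, hNO⟩ := hO
  have hz : B.act z (B.anchor z).1 a₀.2 = z := B.act_unit z _
  change N ∈ 𝓝 (B.act z (B.anchor z).1 a₀.2, z) at hN
  rw [hz, nhds_prod_eq] at hN
  obtain ⟨U, hU, hUN⟩ := Filter.mem_prod_same_iff.1 hN
  obtain ⟨V, hVU, hV, hzV⟩ := mem_nhds_iff.1 hU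
  refine ⟨V, hV, hzV, fun w hw w' hw' e => ?_⟩
  obtain ⟨h, p, rfl⟩ := hf w w' e
  have : h ∈ unitSpace H := hNO (a := ⟨(w, h), p⟩) (hUN ⟨hVU hw', hVU hw⟩)
  exact (B.act_of_unit (Eq.symm this) p).symm

theorem LeftSpace.IsFreeProper.isLocallyInjective {A : LeftSpace G Z} (hG : IsEtale G)
    (hA : A.IsFreeProper) {W : Type*} {f : Z → W}
    (hf : ∀ z w, f z = f w → ∃ (g : G) (p : s g = A.anchor z), A.act g z p = w) :
    IsLocallyInjective f := by
  intro z
  let a₀ : {a : G × Z // s a.1 = A.anchor a.2} := ⟨((A.anchor z).1, z), by simp⟩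
  have hO : {a : {a : G × Z // s a.1 = A.anchor a.2} | a.1.1 ∈ unitSpace G} ∈ 𝓝 a₀ :=
    (hG.isOpen_unitSpace.preimage (continuous_fst.comp continuous_subtype_val)).mem_nhds
      (A.anchor z).2
  rw [hA.isClosedEmbedding.isInducing.nhds_eq_comap, Filter.mem_comap] at hO
  obtain ⟨N, hN, hNO⟩ := hO
  have hz : A.act (A.anchor z).1 z a₀.2 = z := A.unit_act z _
  change N ∈ 𝓝 (A.act (A.anchor z).1 z a₀.2, z) at hN
  rw [hz, nhds_prod_eq] at hN
  obtain ⟨U, hU, hUN⟩ := Filter.mem_prod_same_iff.1 hN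
  obtain ⟨V, hVU, hV, hzV⟩ := mem_nhds_iff.1 hU
  refine ⟨V, hV, hzV, fun w hw w' hw' e => ?_⟩
  obtain ⟨h, p, rfl⟩ := hf w w' e
  have : h ∈ unitSpace G := hNO (a := ⟨(h, w), p⟩) (hUN ⟨hVU hw', hVU hw⟩)
  exact (A.act_of_unit (by rw [← (show rng h = h from this), src_rng]) p).symm

/-- Multiplicativity of `(z, g, w) ↦ (z, h, w)`, where `z · h = g · w`: from `z · h = g · w` and
`w · k = l · v` follows `z · (h k) = (g l) · v`, and the action of `H` is free. -/
theorem LeftSpace.isHom_of_translation {G H : Type u} [ArrowGroupoid G] [ArrowGroupoid H]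
    [TopologicalSpace G] [TopologicalSpace H] {A : LeftSpace G Z} {B : RightSpace H Z}
    (hB : B.IsFreeProper) (hAB : ActionsCommute A B) {c : Ampliation A.anchor → H}
    (hc : ∀ a : Ampliation A.anchor, ∃ p, B.act a.1.1 (c a) p = A.act a.1.2.1 a.1.2.2 a.2.2.symm)
    (hm : ∀ a : Ampliation A.anchor, B.anchor a.1.1 = r (c a) ∧ B.anchor a.1.2.2 = s (c a)) :
    IsHom fun a : Ampliation A.anchor => Ampliation.mk B.anchor a.1.1 (c a) a.1.2.2 (hm a) := by
  obtain ⟨hAB1, hAB2, hAB3⟩ := hAB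
  refine Ampliation.isHom_of_mul (f := fun u => u.1.1.1) (fun _ => rfl) (fun _ => rfl)
    fun a b p q => ?_
  obtain ⟨⟨z, g, w⟩, hz, hw⟩ := a
  obtain ⟨⟨w', k, v⟩, hw', hv⟩ := b
  obtain rfl : w = w' := Ampliation.src_eq_rng_iff.1 p
  obtain ⟨pa, ha⟩ := hc ⟨(z, g, w), hz, hw⟩
  obtain ⟨pb, hb⟩ := hc ⟨(w, k, v), hw', hv⟩
  obtain ⟨pab, hab⟩ := hc (mul ⟨(z, g, w), hz, hw⟩ ⟨(w, k, v), hw', hv⟩ p)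
  set a : Ampliation A.anchor := ⟨(z, g, w), hz, hw⟩
  set b : Ampliation A.anchor := ⟨(w, k, v), hw', hv⟩
  change src (c a) = rng (c b) at q
  change c (mul a b p) = mul (c a) (c b) q
  change B.act z (c a) pa = A.act g w hw.symm at ha
  change B.act w (c b) pb = A.act k v hv.symm at hb
  have e : src g = rng k := Ampliation.isHom_mid.composable p
  change B.act z (c (mul a b p)) pab = A.act (mul g k e) v _ at hab
  have qm : B.anchor z = r (mul (c a) (c b) q) := by rw [r_mul]; exact pa
  refine hB.eq_of_act_eq (z := z) (p := pab) (q := qm) (hab.trans ?_)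
  have q2 : B.anchor (B.act z (c a) pa) = r (c b) := by rw [B.anchor_act]; exact Subtype.ext q
  rw [B.act_mul z (c a) (c b) q qm pa q2, A.mul_act g k v e _ hv.symm
    (by rw [A.anchor_act]; exact Subtype.ext e)]
  have q3 : s g = A.anchor (B.act w (c b) pb) := by rw [hAB2]; exact hw.symm
  rw [B.act_congr ha rfl q2, hAB3 g w (c b) hw.symm pb _ q3]
  exact A.act_congr rfl hb.symm _

/-- For an equivalence `Z`, the anchor maps are local homeomorphisms and the ampliations of `G` and
`H` along them are isomorphic: `(z, g, w)` corresponds to `(z, h, w)` when `z · h = g · w`. -/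
theorem RenaultEquivalent.haveIsomorphicAmpliations {G H : Type u} [ArrowGroupoid G]
    [ArrowGroupoid H] [TopologicalSpace G] [TopologicalSpace H] (hG : IsEtale G) (hH : IsEtale H)
    (h : RenaultEquivalent G H) : HaveIsomorphicAmpliations G H := by
  obtain ⟨Z, _, A, B, hZ, hZ', hA, hB, hAB, ⟨Φ, hΦ⟩, ⟨Ψ, hΨ⟩⟩ := h
  have hAo : ∀ z w, A.anchor z = A.anchor w → ∃ (h : H) (p : B.anchor z = r h), B.act z h p = w :=
    fun z w e => B.exists_act_of_quot_eq (Φ.injective (by rw [hΦ, hΦ, e]))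
  have hBo : ∀ z w, B.anchor z = B.anchor w → ∃ (g : G) (p : s g = A.anchor z), A.act g z p = w :=
    fun z w e => A.exists_act_of_quot_eq (Ψ.injective (by rw [hΨ, hΨ, e]))
  have hAs : Function.Surjective A.anchor := fun x => by
    obtain ⟨⟨z⟩, rfl⟩ := Φ.surjective x
    exact ⟨z, (hΦ z).symm⟩
  have hBs : Function.Surjective B.anchor := fun x => by
    obtain ⟨⟨z⟩, rfl⟩ := Ψ.surjective x
    exact ⟨z, (hΨ z).symm⟩
  have hAl := isLocalHomeomorph_of_locallyInjective A.continuous_anchor A.isOpenMap_anchor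
    (hB.isLocallyInjective hH hAo)
  have hBl := isLocalHomeomorph_of_locallyInjective B.continuous_anchor B.isOpenMap_anchor
    (hA.isLocallyInjective hG hBo)
  refine ⟨Z, Z, inferInstance, inferInstance, A.anchor, B.anchor, hZ, hZ', hZ, hZ', hAl, hAs, hBl,
    hBs, ?_⟩
  have hAact : Continuous fun a : Ampliation A.anchor => A.act a.1.2.1 a.1.2.2 a.2.2.symm :=
    A.continuous_act.comp ((Ampliation.continuous_mid.prodMk Ampliation.continuous_lst).subtype_mk
      fun a => a.2.2.symm)
  have hBact : Continuous fun b : Ampliation B.anchor => B.act b.1.1 b.1.2.1 b.2.1 :=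
    B.continuous_act.comp ((Ampliation.continuous_fst.prodMk Ampliation.continuous_mid).subtype_mk
      fun b => b.2.1)
  obtain ⟨c, hcc, hc⟩ := hB.exists_continuous_translation
    (Ampliation.continuous_fst (φ := A.anchor)) hAact
    fun a => hAo _ _ (by rw [A.anchor_act, a.2.1])
  obtain ⟨d, hdc, hd⟩ := hA.exists_continuous_translation
    (Ampliation.continuous_lst (φ := B.anchor)) hBact
    fun b => hBo _ _ (by rw [B.anchor_act, b.2.2])
  have hcm : ∀ a : Ampliation A.anchor,
      B.anchor a.1.1 = r (c a) ∧ B.anchor a.1.2.2 = s (c a) := fun a => by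
    obtain ⟨p, e⟩ := hc a
    refine ⟨p, ?_⟩
    rw [← B.anchor_act _ _ p, e, hAB.1]
  have hdm : ∀ b : Ampliation B.anchor,
      A.anchor b.1.1 = r (d b) ∧ A.anchor b.1.2.2 = s (d b) := fun b => by
    obtain ⟨p, e⟩ := hd b
    refine ⟨?_, p.symm⟩
    rw [← A.anchor_act _ _ p, e, hAB.2.1]
  refine ⟨{ toFun := fun a => .mk B.anchor a.1.1 (c a) a.1.2.2 (hcm a)
            invFun := fun b => .mk A.anchor b.1.1 (d b) b.1.2.2 (hdm b)
            left_inv := fun a => ?_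
            right_inv := fun b => ?_
            continuous_toFun := Ampliation.continuous_mk Ampliation.continuous_fst hcc
              Ampliation.continuous_lst hcm
            continuous_invFun := Ampliation.continuous_mk Ampliation.continuous_fst hdc
              Ampliation.continuous_lst hdm }, LeftSpace.isHom_of_translation hB hAB hc hcm⟩
  · refine Ampliation.ext (b := a) rfl ?_ rfl
    obtain ⟨p, e⟩ := hc a
    obtain ⟨p', e'⟩ := hd (.mk B.anchor a.1.1 (c a) a.1.2.2 (hcm a))
    exact hA.eq_of_act_eq (e'.trans e)
  · refine Ampliation.ext (b := b) rfl ?_ rfl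
    obtain ⟨p, e⟩ := hd b
    obtain ⟨p', e'⟩ := hc (.mk A.anchor b.1.1 (d b) b.1.2.2 (hdm b))
    exact hB.eq_of_act_eq (e'.trans e)

end Actions

/-! ### Linking groupoids give equivalence spaces -/

section Linking

theorem exists_continuous_lift {X Y T : Type*} [TopologicalSpace X] [TopologicalSpace Y]
    [TopologicalSpace T] {f : X → Y} (hf : IsEmbedding f) {c : T → Y} (hc : Continuous c)
    (h : ∀ t, c t ∈ range f) : ∃ c' : T → X, Continuous c' ∧ ∀ t, f (c' t) = c t := by
  choose c' hc' using h
  refine ⟨c', ?_, hc'⟩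
  rw [hf.isInducing.continuous_iff]
  exact hc.congr fun t => (hc' t).symm

theorem isClosedEmbedding_of_continuous_inverse {X Y : Type*} [TopologicalSpace X]
    [TopologicalSpace Y] {f : X → Y} (hf : Continuous f) {C : Set Y} (hC : IsClosed C)
    (hfC : ∀ x, f x ∈ C) {j : C → X} (hj : Continuous j) (hjf : ∀ x, j ⟨f x, hfC x⟩ = x)
    (hfj : ∀ c, f (j c) = c) : IsClosedEmbedding f := by
  let e : X ≃ₜ C :=
    { toFun := fun x => ⟨f x, hfC x⟩
      invFun := j
      left_inv := hjf
      right_inv := fun c => Subtype.ext (hfj c)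
      continuous_toFun := hf.subtype_mk hfC
      continuous_invFun := hj }
  exact hC.isClosedEmbedding_subtypeVal.comp e.isClosedEmbedding

theorem exists_quot_homeomorph {Z W : Type*} [TopologicalSpace Z] [TopologicalSpace W]
    {R : Z → Z → Prop} {f : Z → W} (hf : Continuous f) (hfo : IsOpenMap f)
    (hfs : Function.Surjective f) (hR : ∀ z w, R z w ↔ f z = f w) :
    ∃ Φ : Quot R ≃ₜ W, ∀ z, Φ (Quot.mk _ z) = f z := by
  let F : Quot R → W := Quot.lift f fun z w h => (hR z w).1 h
  have hF : Continuous F := continuous_quot_lift _ hf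
  have hFb : Function.Bijective F := by
    refine ⟨?_, fun w => ?_⟩
    · rintro ⟨z⟩ ⟨w⟩ h
      exact Quot.sound ((hR z w).2 h)
    · obtain ⟨z, rfl⟩ := hfs w
      exact ⟨Quot.mk _ z, rfl⟩
  have hFo : IsOpenMap F := fun U hU => by
    have : F '' U = f '' (Quot.mk R ⁻¹' U) := by
      ext w
      constructor
      · rintro ⟨⟨z⟩, hz, rfl⟩
        exact ⟨z, hz, rfl⟩
      · rintro ⟨z, hz, rfl⟩
        exact ⟨Quot.mk _ z, hz, rfl⟩
    rw [this]
    exact hfo _ (hU.preimage continuous_quot_mk)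
  exact ⟨(Equiv.ofBijective F hFb).toHomeomorphOfContinuousOpen hF hFo, fun _ => rfl⟩

variable {G : Type*} {H : Type*} {L : Type*} [ArrowGroupoid G] [ArrowGroupoid H] [ArrowGroupoid L]
  [TopologicalSpace G] [TopologicalSpace H] [TopologicalSpace L]

theorem isOpenMap_of_comp_embedding {X Y Z : Type*} [TopologicalSpace X] [TopologicalSpace Y]
    [TopologicalSpace Z] {f : X → Y} {g : Y → Z} (hg : IsEmbedding g)
    (h : IsOpenMap fun x => g (f x)) : IsOpenMap f := fun U hU => by
  have : f '' U = g ⁻¹' ((fun x => g (f x)) '' U) := by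
    ext y
    constructor
    · rintro ⟨x, hx, rfl⟩
      exact ⟨x, hx, rfl⟩
    · rintro ⟨x, hx, h⟩
      exact ⟨x, hx, hg.injective h⟩
  rw [this]
  exact (h U hU).preimage hg.continuous

/-- The arrows of `L` with range in `X` and source in `Y`. -/
abbrev ArrowsBetween (X Y : Set (unitSpace L)) : Type _ := {l : L // r l ∈ X ∧ s l ∈ Y}

/-- The corner at `X` acts on the arrows from `Y` to `X` by left multiplication. -/
theorem IsCorner.exists_leftSpace [T2Space L] (hL : IsEtale L) {f : G → L}
    {X Y : Set (unitSpace L)} (hf : IsCorner f X) (hX : IsOpen X) (hY : IsOpen Y) :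
    ∃ A : LeftSpace G (ArrowsBetween X Y),
      (∀ z, hf.hom.onUnits (A.anchor z) = r z.1) ∧
      (∀ g z p, ∃ q, (A.act g z p).1 = mul (f g) z.1 q) ∧ A.IsFreeProper := by
  have hval : Continuous fun z : ArrowsBetween X Y => z.1 := continuous_subtype_val
  have hrz : Continuous fun z : ArrowsBetween X Y => r z.1 := hL.continuous_r.comp hval
  obtain ⟨u, huc, hu⟩ := exists_continuous_lift hf.isEmbedding_onUnits hrz fun z => by
    rw [hf.range_onUnits]; exact z.2.1
  have hcomp : ∀ {g : G} {z : ArrowsBetween X Y}, s g = u z → src (f g) = rng z.1 := by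
    intro g z p
    have := hu z
    rw [← p, hf.hom.onUnits_s] at this
    exact congrArg Subtype.val this
  let act : (g : G) → (z : ArrowsBetween X Y) → s g = u z → ArrowsBetween X Y := fun g z p =>
    ⟨mul (f g) z.1 (hcomp p), by
      rw [r_mul, s_mul, ← hf.hom.onUnits_r]
      exact ⟨hf.onUnits_mem _, z.2.2⟩⟩
  have huact : ∀ g z p, u (act g z p) = r g := fun g z p => hf.isEmbedding_onUnits.injective (by
    rw [hu, hf.hom.onUnits_r]
    exact r_mul _ _ _)
  have hcact : Continuous
      fun a : {a : G × ArrowsBetween X Y // s a.1 = u a.2} => act a.1.1 a.1.2 a.2 :=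
    (hL.continuous_mul' (hf.isEmbedding.continuous.comp
      (continuous_fst.comp continuous_subtype_val))
      (hval.comp (continuous_snd.comp continuous_subtype_val)) fun a => hcomp a.2).subtype_mk _
  let A : LeftSpace G (ArrowsBetween X Y) :=
    { anchor := u
      continuous_anchor := huc
      isOpenMap_anchor := by
        refine isOpenMap_of_comp_embedding hf.isEmbedding_onUnits ?_
        simp only [hu]
        exact hL.isLocalHomeomorph_r.isOpenMap.comp (((hX.preimage hL.continuous_r).inter
          (hY.preimage hL.continuous_s)).isOpenMap_subtype_val)
      act := act
      continuous_act := hcact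
      anchor_act := huact
      mul_act := fun g h z p q q₁ q₂ => Subtype.ext (by
        simp only [act, hf.hom.map_mul g h p (hf.hom.composable p), mul_assoc_right])
      unit_act := fun z p => Subtype.ext (unit_mul _ _ (congrArg Subtype.val (hu z)) _) }
  refine ⟨A, hu, fun g z p => ⟨hcomp p, rfl⟩, ?_⟩
  let C : Set (ArrowsBetween X Y × ArrowsBetween X Y) := {q | src q.1.1 = src q.2.1}
  have hC : IsClosed C := isClosed_eq (hL.continuous_src.comp (hval.comp continuous_fst))
    (hL.continuous_src.comp (hval.comp continuous_snd))
  have hCc : ∀ q : C, src q.1.1.1 = rng (inv q.1.2.1) := fun q => by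
    rw [rng_inv]; exact q.2
  have hw : Continuous fun q : C => mul q.1.1.1 (inv q.1.2.1) (hCc q) :=
    hL.continuous_mul' (hval.comp (continuous_fst.comp continuous_subtype_val))
      (hL.continuous_inv.comp (hval.comp (continuous_snd.comp continuous_subtype_val))) hCc
  obtain ⟨j, hjc, hj⟩ := exists_continuous_lift hf.isEmbedding hw fun q => by
      rw [hf.mem_range, r_mul, s_mul, s_inv]
      exact ⟨q.1.1.2.1, q.1.2.2.1⟩
  have hju : ∀ q : C, s (j q) = u q.1.2 := fun q => hf.isEmbedding_onUnits.injective (by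
    rw [hu, hf.hom.onUnits_s, hj, s_mul, s_inv])
  have hemb : IsClosedEmbedding fun a : {a : G × ArrowsBetween X Y // s a.1 = A.anchor a.2} =>
      (A.act a.1.1 a.1.2 a.2, a.1.2) := by
    refine isClosedEmbedding_of_continuous_inverse (C := C)
      (hcact.prodMk (continuous_snd.comp continuous_subtype_val))
      hC (fun a => src_mul _ _ _) (j := fun q => ⟨(j q, q.1.2), hju q⟩)
      ((hjc.prodMk (continuous_snd.comp continuous_subtype_val)).subtype_mk _) (fun a => ?_)
      fun q => ?_
    · refine Subtype.ext (Prod.ext (hf.isEmbedding.injective ((hj _).trans ?_)) rfl)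
      change mul (mul (f a.1.1) a.1.2.1 (hcomp a.2)) (inv a.1.2.1) _ = f a.1.1
      rw [mul_assoc_right, mul_congr rfl (comp_inv _)]
      exact mul_unit _ _ (hcomp a.2).symm _
    · refine Prod.ext (Subtype.ext ?_) rfl
      change mul (f (j q)) q.1.2.1 _ = q.1.1.1
      rw [mul_congr (hj q) rfl, mul_assoc_right, mul_congr rfl (inv_comp _)]
      exact mul_unit _ _ q.2.symm _
  exact ⟨hemb.injective, hemb.isProperMap⟩

/-- The corner at `Y` acts on the arrows from `Y` to `X` by right multiplication. -/
theorem IsCorner.exists_rightSpace [T2Space L] (hL : IsEtale L) {f : H → L}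
    {X Y : Set (unitSpace L)} (hf : IsCorner f Y) (hX : IsOpen X) (hY : IsOpen Y) :
    ∃ B : RightSpace H (ArrowsBetween X Y),
      (∀ z, hf.hom.onUnits (B.anchor z) = s z.1) ∧
      (∀ z h p, ∃ q, (B.act z h p).1 = mul z.1 (f h) q) ∧ B.IsFreeProper := by
  have hval : Continuous fun z : ArrowsBetween X Y => z.1 := continuous_subtype_val
  have hsz : Continuous fun z : ArrowsBetween X Y => s z.1 := hL.continuous_s.comp hval
  obtain ⟨u, huc, hu⟩ := exists_continuous_lift hf.isEmbedding_onUnits hsz fun z => by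
    rw [hf.range_onUnits]; exact z.2.2
  have hcomp : ∀ {h : H} {z : ArrowsBetween X Y}, u z = r h → src z.1 = rng (f h) := by
    intro h z p
    have := hu z
    rw [p, hf.hom.onUnits_r] at this
    exact (congrArg Subtype.val this).symm
  let act : (z : ArrowsBetween X Y) → (h : H) → u z = r h → ArrowsBetween X Y := fun z h p =>
    ⟨mul z.1 (f h) (hcomp p), by
      rw [r_mul, s_mul, ← hf.hom.onUnits_s]
      exact ⟨z.2.1, hf.onUnits_mem _⟩⟩
  have huact : ∀ z h p, u (act z h p) = s h := fun z h p => hf.isEmbedding_onUnits.injective (by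
    rw [hu, hf.hom.onUnits_s]
    exact s_mul _ _ _)
  have hcact : Continuous
      fun a : {a : ArrowsBetween X Y × H // u a.1 = r a.2} => act a.1.1 a.1.2 a.2 :=
    (hL.continuous_mul' (hval.comp (continuous_fst.comp continuous_subtype_val))
      (hf.isEmbedding.continuous.comp (continuous_snd.comp continuous_subtype_val))
      fun a => hcomp a.2).subtype_mk _
  let B : RightSpace H (ArrowsBetween X Y) :=
    { anchor := u
      continuous_anchor := huc
      isOpenMap_anchor := by
        refine isOpenMap_of_comp_embedding hf.isEmbedding_onUnits ?_
        simp only [hu]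
        exact hL.isLocalHomeomorph_s.isOpenMap.comp (((hX.preimage hL.continuous_r).inter
          (hY.preimage hL.continuous_s)).isOpenMap_subtype_val)
      act := act
      continuous_act := hcact
      anchor_act := huact
      act_mul := fun z g h p q q₁ q₂ => Subtype.ext (by
        simp only [act, hf.hom.map_mul g h p (hf.hom.composable p), mul_assoc_right])
      act_unit := fun z p => Subtype.ext (mul_unit _ _ (congrArg Subtype.val (hu z)) _) }
  refine ⟨B, hu, fun z h p => ⟨hcomp p, rfl⟩, ?_⟩
  let C : Set (ArrowsBetween X Y × ArrowsBetween X Y) := {q | rng q.1.1 = rng q.2.1}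
  have hC : IsClosed C := isClosed_eq (hL.continuous_rng.comp (hval.comp continuous_fst))
    (hL.continuous_rng.comp (hval.comp continuous_snd))
  have hCc : ∀ q : C, src (inv q.1.2.1) = rng q.1.1.1 := fun q => by
    rw [src_inv]; exact Eq.symm q.2
  have hw : Continuous fun q : C => mul (inv q.1.2.1) q.1.1.1 (hCc q) :=
    hL.continuous_mul'
      (hL.continuous_inv.comp (hval.comp (continuous_snd.comp continuous_subtype_val)))
      (hval.comp (continuous_fst.comp continuous_subtype_val)) hCc
  obtain ⟨j, hjc, hj⟩ := exists_continuous_lift hf.isEmbedding hw fun q => by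
      rw [hf.mem_range, r_mul, s_mul, r_inv]
      exact ⟨q.1.2.2.2, q.1.1.2.2⟩
  have hju : ∀ q : C, u q.1.2 = r (j q) := fun q => hf.isEmbedding_onUnits.injective (by
    rw [hu, hf.hom.onUnits_r, hj, r_mul, r_inv])
  have hemb : IsClosedEmbedding fun a : {a : ArrowsBetween X Y × H // B.anchor a.1 = r a.2} =>
      (B.act a.1.1 a.1.2 a.2, a.1.1) := by
    refine isClosedEmbedding_of_continuous_inverse (C := C)
      (hcact.prodMk (continuous_fst.comp continuous_subtype_val))
      hC (fun a => rng_mul _ _ _) (j := fun q => ⟨(q.1.2, j q), hju q⟩)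
      (((continuous_snd.comp continuous_subtype_val).prodMk hjc).subtype_mk _) (fun a => ?_)
      fun q => ?_
    · refine Subtype.ext (Prod.ext rfl (hf.isEmbedding.injective ((hj _).trans ?_)))
      exact inv_mul_cancel_left _ _ (hcomp a.2) _
    · refine Prod.ext (Subtype.ext ?_) rfl
      change mul q.1.2.1 (f (j q)) _ = q.1.1.1
      rw [mul_congr rfl (hj q), mul_inv_cancel_left]
  exact ⟨hemb.injective, hemb.isProperMap⟩

/-- The arrows from `Y` to `X` in the linking groupoid form an equivalence between `L|_X` and
`L|_Y`. -/
theorem HasAmpleLinkingGroupoid.renaultEquivalent {G H : Type u} [ArrowGroupoid G]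
    [ArrowGroupoid H] [TopologicalSpace G] [TopologicalSpace H] (h : HasAmpleLinkingGroupoid G H) :
    RenaultEquivalent G H := by
  obtain ⟨L, _, _, X, Y, hL, _, -, hX, hY, hXf, hYf, hGX, hHY⟩ := h
  obtain ⟨Φ, hΦ⟩ := hGX.symm
  obtain ⟨Ψ, hΨ⟩ := hHY.symm
  have hf := (isCorner_restriction X).comp_iso hΦ
  have hg := (isCorner_restriction Y).comp_iso hΨ
  set f : G → L := (fun g : Restriction X => (g.1 : L)) ∘ Φ
  set g : H → L := (fun g : Restriction Y => (g.1 : L)) ∘ Ψ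
  have hLe := hL.toIsEtale
  obtain ⟨A, hAu, hAa, hA⟩ := hf.exists_leftSpace hLe hX.isOpen hY.isOpen
  obtain ⟨B, hBu, hBa, hB⟩ := hg.exists_rightSpace hLe hX.isOpen hY.isOpen
  have hZ : LocallyCompactSpace (ArrowsBetween X Y) := by
    have := hLe.locallyCompact
    exact ((hX.isOpen.preimage hLe.continuous_r).inter
      (hY.isOpen.preimage hLe.continuous_s)).locallyCompactSpace
  have hcomm : ActionsCommute A B := by
    refine ⟨fun k z p => ?_, fun z k p => ?_, fun k z l p q q' p' => ?_⟩
    · obtain ⟨q, e⟩ := hAa k z p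
      exact hg.isEmbedding_onUnits.injective (by rw [hBu, hBu, e, s_mul])
    · obtain ⟨q, e⟩ := hBa z k p
      exact hf.isEmbedding_onUnits.injective (by rw [hAu, hAu, e, r_mul])
    · obtain ⟨p1, e1⟩ := hAa k z p
      obtain ⟨p2, e2⟩ := hBa z l q
      obtain ⟨p3, e3⟩ := hBa (A.act k z p) l q'
      obtain ⟨p4, e4⟩ := hAa k (B.act z l q) p'
      refine Subtype.ext ?_
      rw [e3, e4, mul_congr e1 rfl, mul_congr rfl e2, mul_assoc_right]
  refine ⟨ArrowsBetween X Y, inferInstance, A, B, hZ, inferInstance, hA, hB, hcomm, ?_, ?_⟩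
  · refine exists_quot_homeomorph A.continuous_anchor A.isOpenMap_anchor (fun x => ?_)
      fun z w => ⟨?_, fun e => ?_⟩
    · obtain ⟨_, hy, l, hl, rfl⟩ := hYf (hf.hom.onUnits x)
      refine ⟨⟨inv l, by rw [r_inv, hl]; exact hf.onUnits_mem x, by rwa [s_inv]⟩, ?_⟩
      exact hf.isEmbedding_onUnits.injective (by rw [hAu, r_inv, hl])
    · rintro ⟨k, p, rfl⟩
      exact (hcomm.2.1 z k p).symm
    · have e' : src (inv z.1) = rng w.1 := by
        have := congrArg (fun x => (hf.hom.onUnits x).1) e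
        simp only [hAu, r_coe] at this
        rw [src_inv, this]
      obtain ⟨k, hk⟩ := (hg.mem_range (mul (inv z.1) w.1 e')).2
        (by rw [r_mul, r_inv, s_mul]; exact ⟨z.2.2, w.2.2⟩)
      have p : B.anchor z = r k := hg.isEmbedding_onUnits.injective (by
        rw [hBu, hg.hom.onUnits_r, hk, r_mul, r_inv])
      obtain ⟨q, eq⟩ := hBa z k p
      exact ⟨k, p, Subtype.ext (by rw [eq, mul_congr rfl hk, mul_inv_cancel_left])⟩
  · refine exists_quot_homeomorph B.continuous_anchor B.isOpenMap_anchor (fun x => ?_)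
      fun z w => ⟨?_, fun e => ?_⟩
    · obtain ⟨_, hy, l, hl, rfl⟩ := hXf (hg.hom.onUnits x)
      refine ⟨⟨l, hy, by rw [hl]; exact hg.onUnits_mem x⟩, ?_⟩
      exact hg.isEmbedding_onUnits.injective (by rw [hBu, hl])
    · rintro ⟨k, p, rfl⟩
      exact (hcomm.1 k z p).symm
    · have e' : src w.1 = rng (inv z.1) := by
        have := congrArg (fun x => (hg.hom.onUnits x).1) e
        simp only [hBu, s_coe] at this
        rw [rng_inv, this]
      obtain ⟨k, hk⟩ := (hf.mem_range (mul w.1 (inv z.1) e')).2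
        (by rw [r_mul, s_mul, s_inv]; exact ⟨w.2.1, z.2.1⟩)
      have p : s k = A.anchor z := hf.isEmbedding_onUnits.injective (by
        rw [hAu, hf.hom.onUnits_s, hk, s_mul, s_inv])
      obtain ⟨q, eq⟩ := hAa k z p
      refine ⟨k, p, Subtype.ext ?_⟩
      rw [eq, mul_congr hk rfl, mul_assoc_right, mul_congr rfl (inv_comp _)]
      exact mul_unit _ _ (by rw [e', rng_inv]) _

end Linking

/-! ### Ampliations of ample groupoids are ample -/

section AmpleAmpliation

variable {G : Type*} [ArrowGroupoid G] [TopologicalSpace G]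

theorem isTopological_ampliation [T2Space G] (hG : IsEtale G) {X : Type*} [TopologicalSpace X]
    [T2Space X] [LocallyCompactSpace X] {p : X → unitSpace G} (hp : Continuous p) :
    IsTopological (Ampliation p) where
  locallyCompact := by
    have := hG.locallyCompact
    have hc : IsClosed {a : X × G × X | p a.1 = r a.2.1 ∧ p a.2.2 = s a.2.1} :=
      (isClosed_eq (hp.comp continuous_fst)
        (hG.continuous_r.comp (continuous_fst.comp continuous_snd))).inter
      (isClosed_eq (hp.comp (continuous_snd.comp continuous_snd))
        (hG.continuous_s.comp (continuous_fst.comp continuous_snd)))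
    exact hc.isClosedEmbedding_subtypeVal.locallyCompactSpace
  continuous_rng := Ampliation.continuous_mk Ampliation.continuous_fst
    (hG.continuous_rng.comp Ampliation.continuous_mid) Ampliation.continuous_fst
    fun a => (rng a).2
  continuous_src := Ampliation.continuous_mk Ampliation.continuous_lst
    (hG.continuous_src.comp Ampliation.continuous_mid) Ampliation.continuous_lst
    fun a => (src a).2
  continuous_inv := Ampliation.continuous_mk Ampliation.continuous_lst
    (hG.continuous_inv.comp Ampliation.continuous_mid) Ampliation.continuous_fst
    fun a => (inv a).2
  continuous_mul := by
    have h1 : Continuous fun q : {q : Ampliation p × Ampliation p // src q.1 = rng q.2} => q.1.1 :=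
      continuous_fst.comp continuous_subtype_val
    have h2 : Continuous fun q : {q : Ampliation p × Ampliation p // src q.1 = rng q.2} => q.1.2 :=
      continuous_snd.comp continuous_subtype_val
    exact Ampliation.continuous_mk (Ampliation.continuous_fst.comp h1)
      (hG.continuous_mul' (Ampliation.continuous_mid.comp h1) (Ampliation.continuous_mid.comp h2)
        fun q => Ampliation.isHom_mid.composable q.2)
      (Ampliation.continuous_lst.comp h2) fun q => (mul q.1.1 q.1.2 q.2).2
  t2_unitSpace := by
    have : T2Space (Ampliation p) := Ampliation.isEmbedding_val.t2Space
    infer_instance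

theorem isEtale_ampliation [T2Space G] (hG : IsEtale G) {X : Type*} [TopologicalSpace X]
    [T2Space X] [LocallyCompactSpace X] {p : X → unitSpace G} (hp : IsLocalHomeomorph p) :
    IsEtale (Ampliation p) := by
  have htop := isTopological_ampliation hG hp.continuous
  have hfst : IsLocalHomeomorph fun a : Ampliation p => a.1.1 := by
    let E := {e : X × G // p e.1 = r e.2}
    let v : Ampliation p → E := fun a => ⟨(a.1.1, a.1.2.1), a.2.1⟩
    have hE1 : Continuous fun e : E => e.1.1 := continuous_fst.comp continuous_subtype_val
    have hE2 : Continuous fun e : E => e.1.2 := continuous_snd.comp continuous_subtype_val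
    have hv : IsLocalHomeomorph v := by
      refine isLocalHomeomorph_of_isPullback (u := fun a => a.1.2.2) (v := v) hp
        (hG.continuous_s.comp hE2) ?_ (fun a => a.2.2) ?_
      · refine IsEmbedding.of_comp (g := fun q : X × E => (q.2.1.1, q.2.1.2, q.1))
          (Ampliation.continuous_lst.prodMk ((Ampliation.continuous_fst.prodMk
            Ampliation.continuous_mid).subtype_mk _)) ?_ Ampliation.isEmbedding_val
        exact (hE1.comp continuous_snd).prodMk ((hE2.comp continuous_snd).prodMk continuous_fst)
      · rintro y ⟨⟨x, g⟩, hx⟩ e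
        exact ⟨.mk p x g y ⟨hx, e⟩, rfl, rfl⟩
    have hE : IsLocalHomeomorph fun e : E => e.1.1 := by
      refine isLocalHomeomorph_of_isPullback (u := fun e : E => e.1.2) (v := fun e : E => e.1.1)
        hG.isLocalHomeomorph_r hp.continuous ?_ (fun e => e.2.symm) ?_
      · exact (Homeomorph.prodComm X G).isEmbedding.comp IsEmbedding.subtypeVal
      · exact fun g x e => ⟨⟨(x, g), e.symm⟩, rfl, rfl⟩
    exact hE.comp hv
  have hr : IsLocalHomeomorph (r : Ampliation p → unitSpace (Ampliation p)) := by
    rw [show (r : Ampliation p → unitSpace (Ampliation p)) =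
      (Ampliation.unitsHomeo hp.continuous).symm ∘ fun a => a.1.1 from funext Ampliation.r_eq]
    exact (Ampliation.unitsHomeo hp.continuous).symm.isLocalHomeomorph.comp hfst
  refine ⟨htop, ?_, hr, ?_⟩
  · -- near a unit, `p` is injective, so an arrow over a unit of `G` has equal end points
    rw [isOpen_iff_forall_mem_open]
    intro a ha
    obtain ⟨U, hU, haU, hinj⟩ := hp.isLocallyInjective a.1.1
    have ha' : rng a = a := ha
    refine ⟨{b | b.1.1 ∈ U ∧ b.1.2.2 ∈ U ∧ b.1.2.1 ∈ unitSpace G}, ?_,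
      (hU.preimage Ampliation.continuous_fst).inter ((hU.preimage Ampliation.continuous_lst).inter
        (hG.isOpen_unitSpace.preimage Ampliation.continuous_mid)), haU, ?_, ?_⟩
    · rintro b ⟨h1, h2, h3⟩
      have e : b.1.1 = b.1.2.2 := hinj h1 h2 (by
        rw [b.2.1, b.2.2]
        exact (r_unit ⟨_, h3⟩).trans (s_unit ⟨_, h3⟩).symm)
      exact Ampliation.ext rfl h3 e
    · rw [← ha']; exact haU
    · rw [← ha']; exact rng_rng a.1.2.1
  · let i : Ampliation p ≃ₜ Ampliation p :=
      { toFun := inv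
        invFun := inv
        left_inv := inv_inv
        right_inv := inv_inv
        continuous_toFun := htop.continuous_inv
        continuous_invFun := htop.continuous_inv }
    rw [show (s : Ampliation p → unitSpace (Ampliation p)) = r ∘ i from
      funext fun a => (r_inv a).symm]
    exact hr.comp i.isLocalHomeomorph

theorem isAmple_ampliation [T2Space G] (hG : IsAmple G) {X : Type*} [TopologicalSpace X]
    [T2Space X] {p : X → unitSpace G} (hp : IsLocalHomeomorph p) : IsAmple (Ampliation p) := by
  have := hG.prespectralSpace_unitSpace
  have := prespectralSpace_of_isLocalHomeomorph hp
  have hE := isEtale_ampliation hG.toIsEtale hp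
  have := prespectralSpace_of_isLocalHomeomorph
    (Ampliation.unitsHomeo hp.continuous).isLocalHomeomorph
  have := hE.t2_unitSpace
  exact ⟨hE, isClopen_basis_of_prespectralSpace⟩

end AmpleAmpliation

/-! ### Compression of maps between stabilizations -/

section Compression

variable {G : Type*} {H : Type*}

/-- The composite `G → G × 𝓡 → H × 𝓡 → H` of the inclusion at `(0, 0)`, a map, and the
projection. -/
def compress (F : G × FullRel → H × FullRel) (g : G) : H := (F (g, ⟨0, 0⟩)).1

theorem isHom_compress [ArrowGroupoid G] [ArrowGroupoid H]
    {F : G × FullRel → H × FullRel} (hF : IsHom F) : IsHom (compress F) where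
  map_rng g := congrArg Prod.fst (hF.map_rng (g, ⟨0, 0⟩))
  map_src g := congrArg Prod.fst (hF.map_src (g, ⟨0, 0⟩))
  map_mul g h p q := by
    have p' : src (g, FullRel.mk 0 0) = rng (h, FullRel.mk 0 0) := Prod.ext p rfl
    exact congrArg Prod.fst (hF.map_mul _ _ p' (hF.composable p'))

theorem isLocalHomeomorph_compress [TopologicalSpace G] [TopologicalSpace H]
    (F : G × FullRel ≃ₜ H × FullRel) :
    IsLocalHomeomorph (compress F) := by
  have hi : IsLocalHomeomorph fun g : G => (g, FullRel.mk 0 0) :=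
    IsLocalHomeomorph.of_comp (g := Prod.fst) (Homeomorph.refl G).isLocalHomeomorph
      (isLocalHomeomorph_fst_of_discrete G FullRel) (by fun_prop)
  exact (isLocalHomeomorph_fst_of_discrete H FullRel).comp (F.isLocalHomeomorph.comp hi)

end Compression

/-! ### Similarity -/

section Similarity

variable {G : Type*} {H : Type*} [ArrowGroupoid G] [ArrowGroupoid H]
  [TopologicalSpace G] [TopologicalSpace H]

theorem IsHom.isLocalHomeomorph_onUnits (hG : IsEtale G) (hH : IsEtale H) {φ : G → H}
    (hφ : IsHom φ) (h : IsLocalHomeomorph φ) : IsLocalHomeomorph hφ.onUnits :=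
  IsLocalHomeomorph.of_comp
    (h.comp hG.isOpen_unitSpace.isOpenEmbedding_subtypeVal.isLocalHomeomorph)
    hH.isOpen_unitSpace.isOpenEmbedding_subtypeVal.isLocalHomeomorph
    (hφ.continuous_onUnits h.continuous)

/-- If `ρ : G → H` is invertible up to similarity then it is fully faithful: the arrow of `G` over
`(x, h, y)` is `θ(x) σ(h) θ(y)⁻¹`. -/
theorem isomorphic_ampliation_of_similar (hG : IsTopological G) {ρ : G → H} {σ : H → G}
    (hρ : IsHom ρ) (hρc : Continuous ρ) (hσ : IsHom σ) (hσc : Continuous σ)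
    (h1 : SimilarHom (σ ∘ ρ) id) (h2 : SimilarHom (ρ ∘ σ) id) :
    Isomorphic G (Ampliation hρ.onUnits) := by
  obtain ⟨θ, hθc, hθ⟩ := h1
  obtain ⟨τ, -, hτ⟩ := h2
  have hθr : ∀ x, rng (θ x) = x.1 := fun x => by
    obtain ⟨p, q, -⟩ := hθ x.1
    rw [s_unit] at q
    rw [← q]
    exact src_unit x
  have hθs : ∀ x, src (θ x) = σ (ρ x.1) := fun x => by
    obtain ⟨p, -, -⟩ := hθ x.1
    rw [r_unit] at p
    rw [p, Function.comp_apply, ← hσ.map_rng, ← hρ.map_rng, rng_unit]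
  have hb1 : ∀ b : Ampliation hρ.onUnits, src (θ b.1.1) = rng (σ b.1.2.1) := fun b => by
    rw [hθs, ← hσ.map_rng]
    exact congrArg (fun x => σ x.1) b.2.1
  have hb2 : ∀ b : Ampliation hρ.onUnits, src (σ b.1.2.1) = src (θ b.1.2.2) := fun b => by
    rw [hθs, ← hσ.map_src]
    exact congrArg (fun x => σ x.1) b.2.2.symm
  let n : Ampliation hρ.onUnits → G := fun b =>
    mul (θ b.1.1) (mul (σ b.1.2.1) (inv (θ b.1.2.2)) (by rw [hb2, rng_inv]))
      (by rw [rng_mul, hb1])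
  have hnr : ∀ b, r (n b) = b.1.1 := fun b => Subtype.ext (by simp [n, hθr])
  have hns : ∀ b, s (n b) = b.1.2.2 := fun b => Subtype.ext (by simp [n, hθr])
  have hnθ : ∀ b p, mul (n b) (θ b.1.2.2) p = mul (θ b.1.1) (σ b.1.2.1) (hb1 b) := fun b p => by
    simp only [n, mul_assoc_right]
    refine mul_congr rfl ?_ _
    rw [mul_congr rfl (inv_comp _)]
    exact mul_unit _ _ (hb2 b).symm _
  have hρn : ∀ b, ρ (n b) = b.1.2.1 := fun b => by
    have hr : r (ρ (n b)) = r b.1.2.1 := by rw [← hρ.onUnits_r, hnr, b.2.1]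
    have hs : s (ρ (n b)) = s b.1.2.1 := by rw [← hρ.onUnits_s, hns, b.2.2]
    have e1 : σ (ρ (n b)) = σ b.1.2.1 := by
      obtain ⟨p, q, e⟩ := hθ (n b)
      simp only [hnr, hns, id] at p q e
      rw [hnθ b q] at e
      exact mul_left_cancel e
    obtain ⟨p, q, e⟩ := hτ (ρ (n b))
    obtain ⟨p', q', e'⟩ := hτ b.1.2.1
    simp only [Function.comp_apply, e1, hr, hs, id] at e p q
    exact (mul_right_cancel (e'.symm.trans e)).symm
  refine ⟨{ toFun := fun g => .mk hρ.onUnits (r g) (ρ g) (s g) ⟨hρ.onUnits_r g, hρ.onUnits_s g⟩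
            invFun := n
            left_inv := fun g => ?_
            right_inv := fun b => Ampliation.ext (hnr b) (hρn b) (hns b)
            continuous_toFun := Ampliation.continuous_mk hG.continuous_r hρc hG.continuous_s _
            continuous_invFun := hG.continuous_mul' (hθc.comp Ampliation.continuous_fst)
              (hG.continuous_mul' (hσc.comp Ampliation.continuous_mid)
                (hG.continuous_inv.comp (hθc.comp Ampliation.continuous_lst)) _) _ },
    Ampliation.isHom_of_mul (f := fun x => x) (fun _ => rfl) (fun _ => rfl)
      fun g h p q => hρ.map_mul g h p q⟩
  obtain ⟨p, q, e⟩ := hθ g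
  set b : Ampliation hρ.onUnits := .mk hρ.onUnits (r g) (ρ g) (s g) ⟨hρ.onUnits_r g, hρ.onUnits_s g⟩
  have := hnθ b (by rw [← s_coe, hns, hθr])
  exact mul_right_cancel (this.trans e)

theorem isomorphic_ampliation_id (hG : IsTopological G) :
    Isomorphic G (Ampliation (id : unitSpace G → unitSpace G)) :=
  ⟨{ toFun := fun g => .mk id (r g) g (s g) ⟨rfl, rfl⟩
     invFun := fun a => a.1.2.1
     left_inv := fun _ => rfl
     right_inv := fun a => Ampliation.ext a.2.1.symm rfl a.2.2.symm
     continuous_toFun := Ampliation.continuous_mk hG.continuous_r continuous_id hG.continuous_s _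
     continuous_invFun := Ampliation.continuous_mid },
    Ampliation.isHom_of_mul (f := fun x => x) (fun _ => rfl) (fun _ => rfl) fun _ _ _ _ => rfl⟩

theorem isLocalHomeomorph_sumElim {X Y Z : Type*} [TopologicalSpace X] [TopologicalSpace Y]
    [TopologicalSpace Z] {f : X → Z} {g : Y → Z} (hf : IsLocalHomeomorph f)
    (hg : IsLocalHomeomorph g) : IsLocalHomeomorph (Sum.elim f g) := by
  refine isLocalHomeomorph_of_locallyInjective (hf.continuous.sumElim hg.continuous)
    (hf.isOpenMap.sumElim hg.isOpenMap) ?_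
  rintro (x | y)
  · obtain ⟨U, hU, hx, hi⟩ := hf.isLocallyInjective x
    refine ⟨Sum.inl '' U, isOpenMap_inl U hU, ⟨x, hx, rfl⟩, ?_⟩
    rintro _ ⟨a, ha, rfl⟩ _ ⟨b, hb, rfl⟩ h
    rw [hi ha hb h]
  · obtain ⟨U, hU, hx, hi⟩ := hg.isLocallyInjective y
    refine ⟨Sum.inr '' U, isOpenMap_inr U hU, ⟨y, hx, rfl⟩, ?_⟩
    rintro _ ⟨a, ha, rfl⟩ _ ⟨b, hb, rfl⟩ h
    rw [hi ha hb h]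

/-- The linking groupoid of similar groupoids is the ampliation of `H` along
`ρ ⊔ id : G⁽⁰⁾ ⊔ H⁽⁰⁾ → H⁽⁰⁾`. -/
theorem SimilarGroupoids.hasAmpleLinkingGroupoid {G H : Type u} [ArrowGroupoid G]
    [ArrowGroupoid H] [TopologicalSpace G] [TopologicalSpace H] [T2Space G] [T2Space H]
    (hG : IsAmple G) (hH : IsAmple H) (h : SimilarGroupoids G H) :
    HasAmpleLinkingGroupoid G H := by
  obtain ⟨ρ, σ, hρ, hρl, hσ, hσl, h1, h2⟩ := h
  have hGρ := isomorphic_ampliation_of_similar hG.toIsTopological hρ hρl.continuous hσ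
    hσl.continuous h1 h2
  have hHid := isomorphic_ampliation_id hH.toIsTopological
  let q : unitSpace G ⊕ unitSpace H → unitSpace H := Sum.elim hρ.onUnits id
  have hq : IsLocalHomeomorph q := isLocalHomeomorph_sumElim
    (hρ.isLocalHomeomorph_onUnits hG.toIsEtale hH.toIsEtale hρl)
    (Homeomorph.refl _).isLocalHomeomorph
  let b : unitSpace (Ampliation q) → unitSpace G ⊕ unitSpace H := fun x => x.1.1.1
  have hb : Continuous b := Ampliation.continuous_fst.comp continuous_subtype_val
  -- arrows of `H` between the images of two base points connect the units at these points
  have hlink : ∀ (x y : unitSpace G ⊕ unitSpace H) (k : H), q x = r k → q y = s k →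
      Ampliation.unit q x ∈ orbit (Ampliation.unit q y) := fun x y k hx hy =>
    ⟨.mk q x k y ⟨hx, hy⟩, Ampliation.s_eq _, Ampliation.r_eq _⟩
  refine ⟨Ampliation q, inferInstance, inferInstance, b ⁻¹' range Sum.inl, b ⁻¹' range Sum.inr,
    isAmple_ampliation hH hq, Ampliation.isEmbedding_val.t2Space, ?_,
    isClopen_range_inl.preimage hb, isClopen_range_inr.preimage hb, ?_, ?_,
    (isCorner_ampliation_comp (q := q) IsEmbedding.inl).isomorphic.trans hGρ.symm,
    (isCorner_ampliation_comp (q := q) IsEmbedding.inr).isomorphic.trans hHid.symm⟩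
  · refine ⟨isCompl_range_inl_range_inr.disjoint.preimage b, codisjoint_iff.2 ?_⟩
    change b ⁻¹' _ ∪ b ⁻¹' _ = univ
    rw [← preimage_union, range_inl_union_range_inr, preimage_univ]
  · intro u
    rw [← Ampliation.unit_fst u]
    rcases u.1.1.1 with x | y
    · exact ⟨_, ⟨x, rfl⟩, mem_orbit_self _⟩
    · refine ⟨Ampliation.unit q (Sum.inl (hσ.onUnits y)), ⟨_, rfl⟩, ?_⟩
      obtain ⟨τ, -, hτ⟩ := h2
      obtain ⟨p, p', -⟩ := hτ y.1
      rw [r_unit, Function.comp_apply] at p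
      rw [s_unit, id, src_unit] at p'
      refine hlink _ _ (inv (τ y)) (Subtype.ext ?_) (Subtype.ext ?_)
      · rw [r_coe, rng_inv, p, ← hρ.map_rng, ← hσ.map_rng, rng_unit]
        rfl
      · rw [s_coe, src_inv, ← p']
        rfl
  · intro u
    rw [← Ampliation.unit_fst u]
    rcases u.1.1.1 with x | y
    · exact ⟨Ampliation.unit q (Sum.inr (hρ.onUnits x)), ⟨_, rfl⟩,
        hlink _ _ (hρ.onUnits x).1 (r_unit _).symm (s_unit _).symm⟩
    · exact ⟨_, ⟨y, rfl⟩, mem_orbit_self _⟩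

/-- If `F (x, (0, 0)) = (y, (m, m))` for a unit `x`, the arrow `E (y, (m, 0))` connects
`compress E (compress F x)` to `x`. -/
theorem similarHom_compress {F : G × FullRel → H × FullRel} {E : H × FullRel → G × FullRel}
    (hF : IsHom F) (hFc : Continuous F) (hE : IsHom E) (hEc : Continuous E)
    (hEF : ∀ x, E (F x) = x) : SimilarHom (compress E ∘ compress F) id := by
  have hFx : Continuous fun x : unitSpace G => F (x.1, ⟨0, 0⟩) :=
    hFc.comp (continuous_subtype_val.prodMk continuous_const)
  refine ⟨fun x => (E ((F (x.1, ⟨0, 0⟩)).1, ⟨(F (x.1, ⟨0, 0⟩)).2.m, 0⟩)).1,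
    continuous_fst.comp (hEc.comp ((continuous_fst.comp hFx).prodMk (FullRel.continuous_mk
      (continuous_of_discreteTopology.comp (continuous_snd.comp hFx)) continuous_const))),
    fun g => ?_⟩
  have hr : F (rng g, ⟨0, 0⟩) = rng (F (g, ⟨0, 0⟩)) := hF.map_rng (g, ⟨0, 0⟩)
  have hs : F (src g, ⟨0, 0⟩) = src (F (g, ⟨0, 0⟩)) := hF.map_src (g, ⟨0, 0⟩)
  have hg : E (F (g, ⟨0, 0⟩)) = (g, ⟨0, 0⟩) := hEF _
  obtain ⟨⟨k, m, n⟩, hc⟩ : ∃ c, F (g, ⟨0, 0⟩) = c := ⟨_, rfl⟩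
  rw [hc] at hr hs hg
  simp only [r_coe, s_coe, hr, hs, Function.comp_apply, compress, id, hc]
  let a : H × FullRel := (rng k, ⟨m, 0⟩)
  let b : H × FullRel := (k, ⟨0, 0⟩)
  let d : H × FullRel := (src k, ⟨n, 0⟩)
  have hab : src a = rng b := Prod.ext (src_rng k) rfl
  have hcd : src ((k, ⟨m, n⟩) : H × FullRel) = rng d := Prod.ext (rng_src k).symm rfl
  have e : mul a b hab = mul (k, ⟨m, n⟩) d hcd :=
    Prod.ext ((rng_mul_self k).trans (mul_src_self k).symm) rfl
  have e' := congrArg (fun t => (E t).1) e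
  simp only [hE.map_mul _ _ hab (hE.composable hab), hE.map_mul _ _ hcd (hE.composable hcd)] at e'
  have hg1 : (E (k, ⟨m, n⟩)).1 = g := congrArg Prod.fst hg
  have q := congrArg Prod.fst (hE.composable hcd)
  change src (E (k, ⟨m, n⟩)).1 = rng (E d).1 at q
  refine ⟨congrArg Prod.fst (hE.composable hab), hg1 ▸ q, ?_⟩
  exact e'.trans (mul_congr hg1 rfl q)

theorem similarGroupoids_of_isomorphic_prod_fullRel
    (h : Isomorphic (G × FullRel) (H × FullRel)) : SimilarGroupoids G H := by
  obtain ⟨Φ, hΦ⟩ := h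
  have hΨ : IsHom Φ.symm := IsHom.symm (Φ := Φ.toEquiv) hΦ
  exact ⟨compress Φ, compress Φ.symm, isHom_compress hΦ, isLocalHomeomorph_compress Φ,
    isHom_compress hΨ, isLocalHomeomorph_compress Φ.symm,
    similarHom_compress hΦ Φ.continuous hΨ Φ.symm.continuous Φ.symm_apply_apply,
    similarHom_compress hΨ Φ.symm.continuous hΦ Φ.continuous Φ.apply_symm_apply⟩

end Similarity

end TopGpd

theorem mainTheorem4 {G H : Type u}
    [TopGpd.ArrowGroupoid G] [TopologicalSpace G] [TopGpd.ArrowGroupoid H] [TopologicalSpace H]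
    [T2Space G] [T2Space H] [SigmaCompactSpace (TopGpd.unitSpace G)] [SigmaCompactSpace (TopGpd.unitSpace H)]
    (hG : TopGpd.IsAmple G) (hH : TopGpd.IsAmple H) :
    List.TFAE [
      TopGpd.SimilarGroupoids G H,
      TopGpd.MoritaEquivalent G H,
      TopGpd.HasAmpleLinkingGroupoid G H,
      TopGpd.RenaultEquivalent G H,
      TopGpd.HaveIsomorphicAmpliations G H,
      TopGpd.Isomorphic (G × TopGpd.FullRel) (H × TopGpd.FullRel),
      TopGpd.KakutaniEquivalent G H,
      TopGpd.WeaklyKakutaniEquivalent G H] := by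
  tfae_have 1 → 3 := fun h => h.hasAmpleLinkingGroupoid hG hH
  tfae_have 3 → 4 := fun h => h.renaultEquivalent
  tfae_have 4 → 5 := fun h => h.haveIsomorphicAmpliations hG.toIsEtale hH.toIsEtale
  tfae_have 2 → 5 := fun h => h.haveIsomorphicAmpliations hG hH
  tfae_have 5 → 6 := by
    rintro ⟨X, Y, _, _, φ, ψ, -, -, -, -, hφ, hφs, hψ, hψs, h⟩
    exact TopGpd.isomorphic_prod_fullRel_of_ampliation hG hH hφ hφs hψ hψs h
  tfae_have 6 → 1 := TopGpd.similarGroupoids_of_isomorphic_prod_fullRel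
  tfae_have 6 → 7 := TopGpd.kakutaniEquivalent_of_isomorphic_prod_fullRel hG hH
  tfae_have 7 → 8 := fun h => h.weakly
  tfae_have 8 → 2 := fun h => h.moritaEquivalent hG.toIsEtale hH.toIsEtale
  tfae_finish
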